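/- All graphs are finite, undirected, without loops or parallel edges; $v(G)$ is the number of vertices of $G$, $P_n$ is the $n$-vertex path, and $\Lambda = P_3$. A graph is 2-connected if it has at least three vertices, is connected, and remains connected after the deletion of any one vertex; it is claw-free if it has no induced subgraph isomorphic to $K_{1,3}$. For a family $\mathcal F$ of graphs, an $\mathcal F$-factor of $G$ is a spanning subgraph of $G$ each of whose components is isomorphic to a member of $\mathcal F$; a $\Lambda$-factor is a $\{\Lambda\}$-factor (the graph with no vertices has one, namely the empty one). For a subgraph $P$ of $G$, $G - P$ is obtained from $G$ by deleting all vertices of $P$; for an edge $e$ of $G$, $G - e$ is obtained by deleting $e$ only. Let $G$ be a 2-connected claw-free graph. (a1) If $v(G) \equiv 0 \pmod 3$, then for every edge $e$ of $G$ the graph $G - e$ has a $\Lambda$-factor (that is, $G$ has a $\Lambda$-factor avoiding $e$). (a2) If $v(G) \equiv k \pmod 3$ with $k \in \{1,2\}$, then $G$ contains a $k$-vertex path $P_k$ and a $(k+3)$-vertex path $P_{k+3}$ (as not necessarily induced subgraphs) such that $G - P_k$ and $G - P_{k+3}$ both have $\Lambda$-factors; and so $G$ has a $\{\Lambda, P_k\}$-factor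 and a $\{\Lambda, P_{k+3}\}$-factor. -/

import Mathlib

namespace SimpleGraph

/-- `G` is 2-connected: it has more than two vertices, it is connected, and it stays connected
when any single vertex is deleted. -/
def IsTwoConnected {V : Type*} (G : SimpleGraph V) : Prop :=
  2 < ENat.card V ∧ G.Connected ∧ ∀ v : V, (G.induce {v}ᶜ).Connected

/-- `G` is claw-free: no induced subgraph of `G` is isomorphic to the claw `K_{1,3}`. -/
def IsClawFree {V : Type*} (G : SimpleGraph V) : Prop :=
  ¬ (completeBipartiteGraph (Fin 1) (Fin 3)).IsIndContained G

/-- `G` has a `{P_n : n ∈ S}`-factor: a spanning subgraph each of whose connected components is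
isomorphic to the `n`-vertex path `P_n` for some `n ∈ S`. -/
def HasPathFactor {V : Type*} (G : SimpleGraph V) (S : Set ℕ) : Prop :=
  ∃ H : SimpleGraph V, H ≤ G ∧
    ∀ c : H.ConnectedComponent, ∃ n ∈ S, Nonempty (c.toSimpleGraph ≃g pathGraph n)

/-- `G` has a `Λ`-factor, where `Λ` is the 3-vertex path. -/
def HasLambdaFactor {V : Type*} (G : SimpleGraph V) : Prop :=
  G.HasPathFactor {3}

/-- The subgraph `P` is an `n`-vertex path. -/
def Subgraph.IsPathOn {V : Type*} {G : SimpleGraph V} (P : G.Subgraph) (n : ℕ) : Prop :=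
  Nonempty (P.coe ≃g pathGraph n)

/-- `G - P`: the graph obtained from `G` by deleting all vertices of the subgraph `P`. -/
abbrev deleteSubgraph {V : Type*} (G : SimpleGraph V) (P : G.Subgraph) :
    SimpleGraph ↥(P.vertsᶜ) :=
  G.induce P.vertsᶜ

end SimpleGraph

namespace SimpleGraph

/-! ### Connectivity inside a vertex set -/

section Conn

variable {V : Type*} {G : SimpleGraph V}

/-! 2-connectedness is lost as soon as vertices are removed, so the induction runs on a weaker
property, `IsChain`: the blocks form a path whose ends hold the terminals `x` and `y`. In a
2-connected graph the whole vertex set is a chain between any two distinct vertices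
(`IsTwoConnected.isChain_univ`). Hence (a1) for `e = xy` is an instance of `IsChain.tripleFactor`: a
chain with `3m` vertices has a factor into 3-vertex paths avoiding the edge `xy`.

To prove that, delete the terminal `x`. Either a chain remains, starting at a neighbour of `x`, or
two disjoint pieces (lobes) hang off the rest, each by one attachment vertex. Each lobe contains a
neighbour of `x`, so a third disjoint one would give a claw at `x`. Choosing two lobes as large as
possible shows that they and the remainder are themselves chains, arranged cyclically around `x`
(`IsChain.erase_left_or_arms`). Peel up to three vertices `x`, `x'`, `x''` in this way. If only
chains occur, `x x' x''` is one path of the factor and induction handles the rest. If arms appear,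
counting residues mod 3 cuts the set into two smaller chains of size divisible by 3; claw-freeness
at the last peeled vertex supplies the extra edge this may need.

For (a2), the same peeling leaves over a clique `P` on one or two vertices
(`IsChain.exists_clique_tripleFactor`), which is the path `P_k`. By connectedness some edge joins
`P` to a 3-vertex path of the factor, and claw-freeness lets that path be reordered so that it
prolongs `P` (`IsClawFree.exists_path_of_adj`), giving `P_{k+3}`. -/

theorem IsClawFree.adj_of_adj (hG : G.IsClawFree) {c p q r : V} (hp : G.Adj c p) (hq : G.Adj c q)
    (hr : G.Adj c r) (hpq : p ≠ q) (hpr : p ≠ r) (hqr : q ≠ r) :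
    G.Adj p q ∨ G.Adj p r ∨ G.Adj q r := by
  by_contra! hcon
  obtain ⟨h1, h2, h3⟩ := hcon
  have hp' := hp.ne
  have hq' := hq.ne
  have hr' := hr.ne
  refine hG ⟨⟨⟨Sum.elim (fun _ => c) ![p, q, r], ?_⟩, ?_⟩⟩
  · rintro (i | i) (j | j) h
    · exact congrArg _ (Subsingleton.elim _ _)
    · fin_cases j <;> simp_all
    · fin_cases i <;> simp_all
    · fin_cases i <;> fin_cases j <;> simp_all
  · have key : ∀ s t, G.Adj (Sum.elim (fun _ : Fin 1 => c) ![p, q, r] s)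
        (Sum.elim (fun _ : Fin 1 => c) ![p, q, r] t) ↔
        (completeBipartiteGraph (Fin 1) (Fin 3)).Adj s t := by
      rintro (i | i) (j | j)
      · simp
      · fin_cases j <;> simp [hp, hq, hr]
      · fin_cases i <;> simp [hp.symm, hq.symm, hr.symm]
      · fin_cases i <;> fin_cases j <;> simp [h1, h2, h3, G.adj_comm q p, G.adj_comm r p,
          G.adj_comm r q]
    exact @fun s t => key s t

/-- `u` and `v` are joined by a walk of `G` all of whose edges lie inside `S`. -/
def Conn (G : SimpleGraph V) (S : Finset V) (u v : V) : Prop :=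
  Relation.ReflTransGen (fun a b => G.Adj a b ∧ a ∈ S ∧ b ∈ S) u v

namespace Conn

theorem refl (S : Finset V) (u : V) : G.Conn S u u := Relation.ReflTransGen.refl

theorem trans {S : Finset V} {u v w : V} (h : G.Conn S u v) (h' : G.Conn S v w) :
    G.Conn S u w := Relation.ReflTransGen.trans h h'

theorem single {S : Finset V} {u v : V} (h : G.Adj u v) (hu : u ∈ S) (hv : v ∈ S) :
    G.Conn S u v := Relation.ReflTransGen.single ⟨h, hu, hv⟩

theorem symm {S : Finset V} {u v : V} (h : G.Conn S u v) : G.Conn S v u := by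
  induction h with
  | refl => exact refl _ _
  | tail _ h ih => exact (single h.1.symm h.2.2 h.2.1).trans ih

theorem mono {S T : Finset V} (hST : S ⊆ T) {u v : V} (h : G.Conn S u v) : G.Conn T u v :=
  Relation.ReflTransGen.mono (fun _ _ h => ⟨h.1, hST h.2.1, hST h.2.2⟩) _ _ h

theorem mem {S : Finset V} {u v : V} (h : G.Conn S u v) (hu : u ∈ S) : v ∈ S := by
  induction h with
  | refl => exact hu
  | tail _ h _ => exact h.2.2

theorem exists_exit {T P : Finset V} {u v : V} (h : G.Conn T u v) (hu : u ∈ P) (hv : v ∉ P) :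
    ∃ a b, a ∈ P ∧ b ∉ P ∧ G.Adj a b ∧ a ∈ T ∧ b ∈ T := by
  induction h with
  | refl => exact absurd hu hv
  | @tail b c _ h ih =>
    by_cases hb : b ∈ P
    · exact ⟨b, c, hb, hv, h⟩
    · exact ih hb

theorem not_of_notMem {S : Finset V} {u v : V} (hu : u ∈ S) (hv : v ∉ S) : ¬ G.Conn S u v :=
  fun h => hv (h.mem hu)

open Classical in
theorem inside_component {T : Finset V} {w u : V} (h : G.Conn T w u) :
    G.Conn (T.filter (G.Conn T w)) w u := by
  induction h with
  | refl => exact refl _ _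
  | @tail b c hb h ih =>
    refine ih.trans (single h.1 ?_ ?_)
    · exact Finset.mem_filter.2 ⟨h.2.1, hb⟩
    · exact Finset.mem_filter.2 ⟨h.2.2, hb.tail h⟩

variable [DecidableEq V]

/-- A walk through a vertex whose neighbourhood is a clique can be shortcut. -/
theorem erase_of_clique {T : Finset V} {z w u : V}
    (hz : ∀ p ∈ T, ∀ q ∈ T, G.Adj z p → G.Adj z q → p ≠ q → G.Adj p q)
    (h : G.Conn T w u) (hw : w ≠ z) (hu : u ≠ z) : G.Conn (T.erase z) w u := by
  -- The induction must also cover walks currently standing at `z`; there it remembers the vertex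
  -- from which `z` was entered.
  suffices h' : (u ≠ z → G.Conn (T.erase z) w u) ∧
      (u = z → ∃ p ∈ T.erase z, G.Adj p z ∧ G.Conn (T.erase z) w p) from h'.1 hu
  clear hu
  induction h with
  | refl => exact ⟨fun _ => refl _ _, fun h => absurd h hw⟩
  | @tail b c _ h ih =>
    constructor
    · intro hc
      by_cases hb : b = z
      · obtain ⟨p, hp, hpz, hwp⟩ := ih.2 hb
        by_cases hpc : p = c
        · exact hpc ▸ hwp
        · refine hwp.trans (single (hz p (Finset.mem_of_mem_erase hp) c h.2.2 hpz.symm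
            (hb ▸ h.1) hpc) hp (Finset.mem_erase.2 ⟨hc, h.2.2⟩))
      · exact (ih.1 hb).trans (single h.1 (Finset.mem_erase.2 ⟨hb, h.2.1⟩)
          (Finset.mem_erase.2 ⟨hc, h.2.2⟩))
    · rintro rfl
      have hb : b ≠ c := h.1.ne
      exact ⟨b, Finset.mem_erase.2 ⟨hb, h.2.1⟩, h.1, ih.1 hb⟩

/-- A walk can avoid a set `C` that is attached to the rest through a single vertex. -/
theorem sdiff_of_attached {T C : Finset V} {d w u : V}
    (hC : ∀ p ∈ C, ∀ q ∈ T, q ∉ C → G.Adj p q → q = d)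
    (h : G.Conn T w u) (hw : w ∉ C) (hu : u ∉ C) : G.Conn (T \ C) w u := by
  -- While the walk is inside `C`, its replacement waits at `d`, the only door.
  suffices h' : (u ∉ C → G.Conn (T \ C) w u) ∧ (u ∈ C → G.Conn (T \ C) w d) from h'.1 hu
  clear hu
  induction h with
  | refl => exact ⟨fun _ => refl _ _, fun h => absurd h hw⟩
  | @tail b c _ h ih =>
    constructor
    · intro hc
      by_cases hb : b ∈ C
      · rw [hC b hb c h.2.2 hc h.1]
        exact ih.2 hb
      · exact (ih.1 hb).trans (single h.1 (Finset.mem_sdiff.2 ⟨h.2.1, hb⟩)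
          (Finset.mem_sdiff.2 ⟨h.2.2, hc⟩))
    · intro hc
      by_cases hb : b ∈ C
      · exact ih.2 hb
      · rw [← hC c hc b h.2.1 hb h.1.symm]
        exact ih.1 hb

end Conn

/-- `C` is a connected part of `S` that misses `y` and is attached to the rest of `S` only
through `d`. -/
structure IsLobe (G : SimpleGraph V) (S : Finset V) (y d : V) (C : Finset V) : Prop where
  subset : C ⊆ S
  att_mem : d ∈ S
  att_notMem : d ∉ C
  root_notMem : y ∉ C
  nonempty : C.Nonempty
  att : ∀ u ∈ C, ∀ w ∈ S, w ∉ C → G.Adj u w → w = d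
  conn : ∀ u ∈ C, ∀ w ∈ C, G.Conn C u w

namespace IsLobe

variable {S C C₁ C₂ : Finset V} {y d d₁ d₂ : V}

theorem exists_adj (hS : ∀ w ∈ S, G.Conn S w y) (h : G.IsLobe S y d C) : ∃ b ∈ C, G.Adj b d := by
  obtain ⟨u, hu⟩ := h.nonempty
  obtain ⟨a, b, ha, hb, hab, -, hbS⟩ := (hS u (h.subset hu)).exists_exit hu h.root_notMem
  exact ⟨a, ha, h.att a ha b hbS hb hab ▸ hab⟩

end IsLobe

/-! ### Chains -/

variable [DecidableEq V]

/-- `S` is connected, and deleting any vertex of `S` leaves every remaining vertex joined to one of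
the terminals `x`, `y`: the blocks of `G[S]` form a path with ends at `x` and `y`. -/
structure IsChain (G : SimpleGraph V) (S : Finset V) (x y : V) : Prop where
  left_mem : x ∈ S
  right_mem : y ∈ S
  conn : ∀ w ∈ S, G.Conn S w y
  cut : ∀ v ∈ S, ∀ w ∈ S, w ≠ v → G.Conn (S.erase v) w x ∨ G.Conn (S.erase v) w y

namespace IsChain

theorem symm {S : Finset V} {x y : V} (h : G.IsChain S x y) : G.IsChain S y x :=
  ⟨h.right_mem, h.left_mem, fun w hw => (h.conn w hw).trans (h.conn x h.left_mem).symm,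
    fun v hv w hw hne => (h.cut v hv w hw hne).symm⟩

theorem singleton (x : V) : G.IsChain {x} x x := by
  refine ⟨by simp, by simp, ?_, ?_⟩
  · intro w hw
    rw [Finset.mem_singleton.1 hw]
    exact Conn.refl _ _
  · intro v hv w hw hne
    exact absurd ((Finset.mem_singleton.1 hw).trans (Finset.mem_singleton.1 hv).symm) hne

/-- After deleting `x`, any other vertex would have no terminal left to reach. -/
theorem eq_singleton {S : Finset V} {x : V} (h : G.IsChain S x x) : S = {x} := by
  refine Finset.eq_singleton_iff_unique_mem.2 ⟨h.left_mem, fun w hw => ?_⟩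
  by_contra hne
  have := h.cut x h.left_mem w hw hne
  exact Conn.not_of_notMem (Finset.mem_erase.2 ⟨hne, hw⟩) (by simp) (this.elim id id)

theorem conn_erase_left {S : Finset V} {x y : V} (h : G.IsChain S x y) :
    ∀ w ∈ S.erase x, G.Conn (S.erase x) w y := fun w hw =>
  (h.cut x h.left_mem w (Finset.mem_of_mem_erase hw) (Finset.ne_of_mem_erase hw)).resolve_left
    (Conn.not_of_notMem hw (by simp))

/-- Deleting a vertex of one part leaves the other part intact, so a vertex still joined to the
inner terminal of its own part crosses the edge `bc` and runs on to the outer terminal. -/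
theorem append {A B : Finset V} {a b c d : V} (hA : G.IsChain A a b) (hB : G.IsChain B c d)
    (hAB : Disjoint A B) (hbc : G.Adj b c) : G.IsChain (A ∪ B) a d := by
  have key : ∀ v ∈ A, ∀ w ∈ A, w ≠ v → G.Conn ((A ∪ B).erase v) w a ∨
      G.Conn ((A ∪ B).erase v) w d := by
    intro v hv w hw hne
    have hvB : v ∉ B := Finset.disjoint_left.1 hAB hv
    have hBs : B ⊆ (A ∪ B).erase v := fun z hz =>
      Finset.mem_erase.2 ⟨fun h => hvB (by rwa [← h]), Finset.mem_union_right _ hz⟩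
    have hAs : A.erase v ⊆ (A ∪ B).erase v := Finset.erase_subset_erase _ Finset.subset_union_left
    refine (hA.cut v hv w hw hne).imp (Conn.mono hAs) fun h => ?_
    have hb : b ∈ A.erase v := h.mem (Finset.mem_erase.2 ⟨hne, hw⟩)
    exact (h.mono hAs).trans ((Conn.single hbc (hAs hb) (hBs hB.left_mem)).trans
      ((hB.conn c hB.left_mem).mono hBs))
  have key' : ∀ v ∈ B, ∀ w ∈ A, G.Conn ((A ∪ B).erase v) w a := by
    intro v hv w hw
    have hvA : v ∉ A := Finset.disjoint_right.1 hAB hv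
    refine (hA.symm.conn w hw).mono fun z hz =>
      Finset.mem_erase.2 ⟨fun h => hvA (by rwa [← h]), Finset.mem_union_left _ hz⟩
  have key2 : ∀ v ∈ A, ∀ w ∈ B, G.Conn ((A ∪ B).erase v) w d := by
    intro v hv w hw
    have hvB : v ∉ B := Finset.disjoint_left.1 hAB hv
    refine (hB.conn w hw).mono fun z hz =>
      Finset.mem_erase.2 ⟨fun h => hvB (by rwa [← h]), Finset.mem_union_right _ hz⟩
  have key3 : ∀ v ∈ B, ∀ w ∈ B, w ≠ v → G.Conn ((A ∪ B).erase v) w a ∨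
      G.Conn ((A ∪ B).erase v) w d := by
    intro v hv w hw hne
    have hvA : v ∉ A := Finset.disjoint_right.1 hAB hv
    have hAs : A ⊆ (A ∪ B).erase v := fun z hz =>
      Finset.mem_erase.2 ⟨fun h => hvA (by rwa [← h]), Finset.mem_union_left _ hz⟩
    have hBs : B.erase v ⊆ (A ∪ B).erase v := Finset.erase_subset_erase _ Finset.subset_union_right
    refine (hB.cut v hv w hw hne).imp (fun h => ?_) (Conn.mono hBs)
    have hc : c ∈ B.erase v := h.mem (Finset.mem_erase.2 ⟨hne, hw⟩)
    exact (h.mono hBs).trans ((Conn.single hbc.symm (hBs hc) (hAs hA.right_mem)).trans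
      ((hA.symm.conn b hA.right_mem).mono hAs))
  refine ⟨Finset.mem_union_left _ hA.left_mem, Finset.mem_union_right _ hB.right_mem, ?_, ?_⟩
  · intro w hw
    rcases Finset.mem_union.1 hw with hw | hw
    · exact ((hA.conn w hw).mono Finset.subset_union_left).trans
        ((Conn.single hbc (Finset.mem_union_left _ hA.right_mem)
          (Finset.mem_union_right _ hB.left_mem)).trans
          ((hB.conn c hB.left_mem).mono Finset.subset_union_right))
    · exact (hB.conn w hw).mono Finset.subset_union_right
  · intro v hv w hw hne
    rcases Finset.mem_union.1 hv with hv | hv <;> rcases Finset.mem_union.1 hw with hw | hw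
    · exact key v hv w hw hne
    · exact Or.inr (key2 v hv w hw)
    · exact Or.inl (key' v hv w hw)
    · exact key3 v hv w hw hne

theorem cons {B : Finset V} {x c d : V} (hB : G.IsChain B c d) (hx : x ∉ B) (hxc : G.Adj x c) :
    G.IsChain (insert x B) x d := by
  have := (singleton (G := G) x).append hB (Finset.disjoint_singleton_left.2 hx) hxc
  rwa [← Finset.insert_eq] at this

theorem erase_of_clique {S : Finset V} {x y z : V} (h : G.IsChain S x y) (hx : x ≠ z) (hy : y ≠ z)
    (hz : ∀ p ∈ S, ∀ q ∈ S, G.Adj z p → G.Adj z q → p ≠ q → G.Adj p q) :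
    G.IsChain (S.erase z) x y := by
  refine ⟨Finset.mem_erase.2 ⟨hx, h.left_mem⟩, Finset.mem_erase.2 ⟨hy, h.right_mem⟩, ?_, ?_⟩
  · intro w hw
    exact (h.conn w (Finset.mem_of_mem_erase hw)).erase_of_clique hz (Finset.ne_of_mem_erase hw) hy
  · intro v hv w hw hne
    rw [Finset.erase_right_comm]
    have hz' : ∀ p ∈ S.erase v, ∀ q ∈ S.erase v, G.Adj z p → G.Adj z q → p ≠ q → G.Adj p q :=
      fun p hp q hq => hz p (Finset.mem_of_mem_erase hp) q (Finset.mem_of_mem_erase hq)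
    exact (h.cut v (Finset.mem_of_mem_erase hv) w (Finset.mem_of_mem_erase hw) hne).imp
      (fun h => h.erase_of_clique hz' (Finset.ne_of_mem_erase hw) hx)
      (fun h => h.erase_of_clique hz' (Finset.ne_of_mem_erase hw) hy)

end IsChain

/-! ### Lobes: laminarity, and what deleting a terminal leaves -/

namespace IsLobe

variable {S C C₁ C₂ : Finset V} {y d d₁ d₂ : V}

/-- If each lobe contained the attachment of the other, no edge would leave `C₁ ∪ C₂`, although its
vertices are joined to `y`. -/
theorem not_crossing (hS : ∀ w ∈ S, G.Conn S w y) (h₁ : G.IsLobe S y d₁ C₁)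
    (h₂ : G.IsLobe S y d₂ C₂) : d₁ ∉ C₂ ∨ d₂ ∉ C₁ := by
  by_contra! hcon
  obtain ⟨u, hu⟩ := h₁.nonempty
  have hy : y ∉ C₁ ∪ C₂ := by simp [h₁.root_notMem, h₂.root_notMem]
  obtain ⟨a, b, ha, hb, hab, -, hbS⟩ :=
    (hS u (h₁.subset hu)).exists_exit (P := C₁ ∪ C₂) (Finset.mem_union_left _ hu) hy
  rw [Finset.mem_union, not_or] at hb
  rcases Finset.mem_union.1 ha with ha | ha
  · exact hb.2 (h₁.att a ha b hbS hb.1 hab ▸ hcon.1)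
  · exact hb.1 (h₂.att a ha b hbS hb.2 hab ▸ hcon.2)

theorem att_notMem_of_disjoint (hS : ∀ w ∈ S, G.Conn S w y) (h₁ : G.IsLobe S y d₁ C₁)
    (h₂ : G.IsLobe S y d₂ C₂) (hd : Disjoint C₁ C₂) : d₁ ∉ C₂ := by
  intro hd1
  obtain ⟨b, hb, hbd⟩ := h₁.exists_adj hS
  have : b = d₂ := h₂.att d₁ hd1 b (h₁.subset hb) (Finset.disjoint_left.1 hd hb) hbd.symm
  rcases h₁.not_crossing hS h₂ with h | h
  · exact h hd1
  · exact h (this ▸ hb)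

theorem not_adj_of_disjoint (hS : ∀ w ∈ S, G.Conn S w y) (h₁ : G.IsLobe S y d₁ C₁)
    (h₂ : G.IsLobe S y d₂ C₂) (hd : Disjoint C₁ C₂) {u w : V} (hu : u ∈ C₁) (hw : w ∈ C₂) :
    ¬ G.Adj u w := fun h =>
  h₁.att_notMem_of_disjoint hS h₂ hd
    (h₁.att u hu w (h₂.subset hw) (Finset.disjoint_right.1 hd hw) h ▸ hw)

theorem subset_of_att_notMem (h₁ : G.IsLobe S y d₁ C₁) (h₂ : G.IsLobe S y d₂ C₂)
    (hd : ¬ Disjoint C₁ C₂) (h : d₂ ∉ C₁) : C₁ ⊆ C₂ := by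
  obtain ⟨u, hu1, hu2⟩ := Finset.not_disjoint_iff.1 hd
  intro w hw
  by_contra hw2
  obtain ⟨a, b, ha, hb, hab, -, hb1⟩ := (h₁.conn u hu1 w hw).exists_exit hu2 hw2
  exact h (h₂.att a ha b (h₁.subset hb1) hb hab ▸ hb1)

/-- A connected lobe can leave an overlapping one only through the attachment of the latter; by
`not_crossing` this fails in at least one direction. -/
theorem laminar (hS : ∀ w ∈ S, G.Conn S w y) (h₁ : G.IsLobe S y d₁ C₁)
    (h₂ : G.IsLobe S y d₂ C₂) (hd : ¬ Disjoint C₁ C₂) : C₁ ⊆ C₂ ∨ C₂ ⊆ C₁ := by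
  rcases h₁.not_crossing hS h₂ with h | h
  · exact Or.inr (h₂.subset_of_att_notMem h₁ (fun h' => hd h'.symm) h)
  · exact Or.inl (h₁.subset_of_att_notMem h₂ hd h)

-- The source of all lobes: a component of `S - v` that is cut off from the root.
open Classical in
theorem of_not_conn {v w : V} (hv : v ∈ S) (hw : w ∈ S) (hne : w ≠ v)
    (h : ¬ G.Conn (S.erase v) w y) :
    G.IsLobe S y v ((S.erase v).filter (G.Conn (S.erase v) w)) := by
  have hw' : w ∈ S.erase v := Finset.mem_erase.2 ⟨hne, hw⟩
  refine ⟨(Finset.filter_subset _ _).trans (Finset.erase_subset _ _), hv, by simp,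
    fun hy => h (Finset.mem_filter.1 hy).2, ⟨w, Finset.mem_filter.2 ⟨hw', Conn.refl _ _⟩⟩, ?_, ?_⟩
  · intro u hu z hz hzn huz
    by_contra hzv
    have hz' : z ∈ S.erase v := Finset.mem_erase.2 ⟨hzv, hz⟩
    rw [Finset.mem_filter] at hu
    exact hzn (Finset.mem_filter.2 ⟨hz', hu.2.trans (Conn.single huz hu.1 hz')⟩)
  · intro u hu z hz
    exact (Conn.inside_component (Finset.mem_filter.1 hu).2).symm.trans
      (Conn.inside_component (Finset.mem_filter.1 hz).2)

end IsLobe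

/-- With `d` deleted from `S`, the lobe must still reach `x` or `y`, and the only way out is an edge
to `x`. -/
theorem IsChain.lobe_exists_adj {S C : Finset V} {x y d : V} (h : G.IsChain S x y)
    (hC : G.IsLobe (S.erase x) y d C) : ∃ u ∈ C, G.Adj x u := by
  obtain ⟨w, hw⟩ := hC.nonempty
  have hxC : x ∉ C := fun hx => by simpa using hC.subset hx
  have hwd : w ≠ d := fun h => hC.att_notMem (h ▸ hw)
  have key : ∀ z, z ∉ C → G.Conn (S.erase d) w z → ∃ u ∈ C, G.Adj x u := by
    intro z hz hwz
    obtain ⟨a, b, ha, hb, hab, -, hbS⟩ := hwz.exists_exit hw hz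
    by_cases hbx : b = x
    · exact ⟨a, ha, hbx ▸ hab.symm⟩
    · refine absurd (hC.att a ha b ?_ hb hab) (Finset.ne_of_mem_erase hbS)
      exact Finset.mem_erase.2 ⟨hbx, Finset.mem_of_mem_erase hbS⟩
  rcases h.cut d (Finset.mem_of_mem_erase hC.att_mem) w
    (Finset.mem_of_mem_erase (hC.subset hw)) hwd with h | h
  · exact key x hxC h
  · exact key y hC.root_notMem h

/-- Start the new chain at a neighbour `x₁` of `x` in a smallest lobe `C₁`. If this fails, some `v`
cuts off a lobe avoiding `x₁`; by laminarity and minimality it is disjoint from `C₁`. If there are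
no lobes, any neighbour of `x` serves. -/
theorem IsChain.erase_left_or_lobes {S : Finset V} {x y : V} (h : G.IsChain S x y) (hxy : x ≠ y) :
    (∃ x' ∈ S.erase x, G.Adj x x' ∧ G.IsChain (S.erase x) x' y) ∨
    ∃ d₁ C₁ d₂ C₂, G.IsLobe (S.erase x) y d₁ C₁ ∧ G.IsLobe (S.erase x) y d₂ C₂ ∧
      Disjoint C₁ C₂ := by
  classical
  have hT := h.conn_erase_left
  have hy : y ∈ S.erase x := Finset.mem_erase.2 ⟨hxy.symm, h.right_mem⟩
  by_cases hex : ∃ d C, G.IsLobe (S.erase x) y d C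
  · obtain ⟨d, C, hC⟩ := hex
    obtain ⟨C₁, hC₁, hmin⟩ := Finset.exists_min_image
      ((S.erase x).powerset.filter fun C => ∃ d, G.IsLobe (S.erase x) y d C) Finset.card
      ⟨C, Finset.mem_filter.2 ⟨Finset.mem_powerset.2 hC.subset, d, hC⟩⟩
    obtain ⟨-, d₁, hL₁⟩ := Finset.mem_filter.1 hC₁
    obtain ⟨x₁, hx₁, hadj⟩ := h.lobe_exists_adj hL₁
    by_cases hch : G.IsChain (S.erase x) x₁ y
    · exact Or.inl ⟨x₁, hL₁.subset hx₁, hadj, hch⟩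
    · right
      have : ∃ v ∈ S.erase x, ∃ w ∈ S.erase x, w ≠ v ∧ ¬ G.Conn ((S.erase x).erase v) w x₁ ∧
          ¬ G.Conn ((S.erase x).erase v) w y := by
        by_contra! hcon
        refine hch ⟨hL₁.subset hx₁, hy, hT, fun v hv w hw hne => ?_⟩
        by_contra! hc
        exact hc.2 (hcon v hv w hw hne hc.1)
      obtain ⟨v, hv, w, hw, hne, h1, h2⟩ := this
      have hU := IsLobe.of_not_conn hv hw hne h2
      refine ⟨d₁, C₁, v, _, hL₁, hU, ?_⟩
      by_contra hd
      have hx₁U : x₁ ∉ ((S.erase x).erase v).filter (G.Conn ((S.erase x).erase v) w) :=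
        fun hx => h1 (Finset.mem_filter.1 hx).2
      rcases hL₁.laminar hT hU hd with hs | hs
      · exact hx₁U (hs hx₁)
      · have := hmin _ (Finset.mem_filter.2 ⟨Finset.mem_powerset.2 hU.subset, v, hU⟩)
        exact hx₁U (Finset.eq_of_subset_of_card_le hs this ▸ hx₁)
  · left
    obtain ⟨a, b, ha, hb, hab, -, hbS⟩ := (h.conn x h.left_mem).exists_exit (P := {x})
      (Finset.mem_singleton_self x) (by simpa using hxy.symm)
    rw [Finset.mem_singleton] at ha hb
    subst ha
    refine ⟨b, Finset.mem_erase.2 ⟨hb, hbS⟩, hab, Finset.mem_erase.2 ⟨hb, hbS⟩, hy, hT, ?_⟩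
    intro v hv w hw hne
    by_contra! hc
    exact hex ⟨_, _, IsLobe.of_not_conn hv hw hne hc.2⟩

/-- Two disjoint lobes would contain nonadjacent neighbours of `x`. Lobes avoid `y`, so `y` may be
exempted from the clique condition; this is used when `x` is adjacent to the other terminal. -/
theorem IsChain.erase_left_of_clique {S : Finset V} {x y : V} (h : G.IsChain S x y) (hxy : x ≠ y)
    (hx : ∀ p ∈ S, ∀ q ∈ S, G.Adj x p → G.Adj x q → p ≠ q → p ≠ y → q ≠ y → G.Adj p q) :
    ∃ x' ∈ S.erase x, G.Adj x x' ∧ G.IsChain (S.erase x) x' y := by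
  refine (h.erase_left_or_lobes hxy).resolve_right ?_
  rintro ⟨d₁, C₁, d₂, C₂, h₁, h₂, hd⟩
  obtain ⟨p, hp, hxp⟩ := h.lobe_exists_adj h₁
  obtain ⟨q, hq, hxq⟩ := h.lobe_exists_adj h₂
  refine h₁.not_adj_of_disjoint h.conn_erase_left h₂ hd hp hq
    (hx p (Finset.mem_of_mem_erase (h₁.subset hp)) q (Finset.mem_of_mem_erase (h₂.subset hq))
      hxp hxq ?_ ?_ ?_)
  · rintro rfl
    exact Finset.disjoint_left.1 hd hp hq
  · rintro rfl
    exact h₁.root_notMem hp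
  · rintro rfl
    exact h₂.root_notMem hq

end Conn

end SimpleGraph
namespace SimpleGraph

/-! ### Arms: the cyclic structure when no chain remains -/

section Arms

variable {V : Type*} [DecidableEq V] {G : SimpleGraph V}

/-- A lobe of `S - x` whose two attachments are cliques is a chain between them. -/
theorem IsLobe.exists_isChain {S C : Finset V} {x y d : V} (hC : G.IsLobe (S.erase x) y d C)
    (h : G.IsChain S x y)
    (hx : ∀ p ∈ C, ∀ q ∈ C, G.Adj x p → G.Adj x q → p ≠ q → G.Adj p q)
    (hd : ∀ p ∈ C, ∀ q ∈ C, G.Adj d p → G.Adj d q → p ≠ q → G.Adj p q) :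
    ∃ a b, G.Adj x a ∧ G.Adj b d ∧ G.IsChain C a b := by
  obtain ⟨a₀, ha₀, hxa₀⟩ := h.lobe_exists_adj hC
  obtain ⟨b₀, hb₀, hbd₀⟩ := hC.exists_adj h.conn_erase_left
  have hxC : x ∉ C := fun hx => by simpa using hC.subset hx
  have hdC := hC.att_notMem
  have hxd : x ≠ d := (Finset.ne_of_mem_erase hC.att_mem).symm
  have toD : ∀ w ∈ C, G.Conn (insert d C) w d := fun w hw =>
    ((hC.conn w hw b₀ hb₀).mono (Finset.subset_insert _ _)).trans
      (Conn.single hbd₀ (Finset.mem_insert_of_mem hb₀) (Finset.mem_insert_self _ _))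
  have toX : ∀ w ∈ C, G.Conn (insert x C) w x := fun w hw =>
    ((hC.conn w hw a₀ ha₀).mono (Finset.subset_insert _ _)).trans
      (Conn.single hxa₀.symm (Finset.mem_insert_of_mem ha₀) (Finset.mem_insert_self _ _))
  -- Put `x` and `d` back as terminals to get a chain, then strip them off again one at a time by
  -- the clique criterion.
  have hM : G.IsChain (insert x (insert d C)) x d := by
    refine ⟨by simp, by simp, ?_, ?_⟩
    · have hCD : ∀ w ∈ C, G.Conn (insert x (insert d C)) w d := fun w hw =>
        (toD w hw).mono (Finset.subset_insert _ _)
      intro w hw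
      simp only [Finset.mem_insert] at hw
      rcases hw with rfl | rfl | hw
      · exact (Conn.single hxa₀ (by simp) (by simp [ha₀])).trans (hCD a₀ ha₀)
      · exact Conn.refl _ _
      · exact hCD w hw
    · intro v hv w hw hne
      by_cases hwx : w = x
      · exact Or.inl (hwx ▸ Conn.refl _ _)
      by_cases hwd : w = d
      · exact Or.inr (hwd ▸ Conn.refl _ _)
      have hwC : w ∈ C := by simpa [hwx, hwd] using hw
      by_cases hvx : v = x
      · subst hvx
        refine Or.inr ((toD w hwC).mono ?_)
        rw [Finset.erase_insert (by simp [hxd, hxC])]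
      by_cases hvd : v = d
      · subst hvd
        refine Or.inl ((toX w hwC).mono ?_)
        intro z hz
        rw [Finset.mem_insert] at hz
        rcases hz with rfl | hz
        · simp [hxd]
        · have : z ≠ v := fun h => hdC (h ▸ hz)
          simp [this, hz]
      have hvC : v ∈ C := by simpa [hvx, hvd] using hv
      by_contra! hcon
      classical
      -- A walk in `S - v` leaving `C` does so through `x` or `d`, both of which `w` is assumed not
      -- to reach; hence `v` would cut `w` from both terminals of `S`.
      have key : ∀ z, z ∉ C → ¬ G.Conn (S.erase v) w z := by
        intro z hz hwz
        set M := (insert x (insert d C)).erase v with hMdef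
        have hwM : w ∈ M := by simp [hMdef, hne, hwC]
        obtain ⟨a, b, ha, hb, hab, -, hbS⟩ := hwz.exists_exit (P := C.filter (G.Conn M w))
          (Finset.mem_filter.2 ⟨hwC, Conn.refl _ _⟩) (fun h => hz (Finset.mem_filter.1 h).1)
        rw [Finset.mem_filter] at ha hb
        have hbv := Finset.ne_of_mem_erase hbS
        have step : b ∈ M → G.Conn M w b := fun hbM =>
          ha.2.trans (Conn.single hab (ha.2.mem hwM) hbM)
        by_cases hbC : b ∈ C
        · exact hb ⟨hbC, step (by simp [hMdef, hbv, hbC])⟩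
        · by_cases hbx : b = x
          · subst hbx
            exact hcon.1 (step (by simp [hMdef, hbv]))
          · have : b = d := hC.att a ha.1 b (Finset.mem_erase.2
              ⟨hbx, Finset.mem_of_mem_erase hbS⟩) hbC hab
            subst this
            exact hcon.2 (step (by simp [hMdef, hbv]))
      exact (h.cut v (Finset.mem_of_mem_erase (hC.subset hvC)) w
        (Finset.mem_of_mem_erase (hC.subset hwC)) hne).elim (key x hxC) (key y hC.root_notMem)
  obtain ⟨a, ha, hxa, hch⟩ := hM.erase_left_of_clique hxd (by
    intro p hp q hq hxp hxq hpq hpd hqd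
    have hp' : p ∈ C := by simpa [hxp.ne.symm, hpd] using hp
    have hq' : q ∈ C := by simpa [hxq.ne.symm, hqd] using hq
    exact hx p hp' q hq' hxp hxq hpq)
  rw [Finset.erase_insert (by simp [hxd, hxC])] at hch
  have had : d ≠ a := by
    rintro rfl
    have := hch.eq_singleton
    have hb : b₀ ∈ insert d C := Finset.mem_insert_of_mem hb₀
    rw [this, Finset.mem_singleton] at hb
    exact hdC (hb ▸ hb₀)
  obtain ⟨b, -, hdb, hch'⟩ := hch.symm.erase_left_of_clique had (by
    intro p hp q hq hdp hdq hpq _ _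
    have hp' : p ∈ C := by simpa [hdp.ne.symm] using hp
    have hq' : q ∈ C := by simpa [hdq.ne.symm] using hq
    exact hd p hp' q hq' hdp hdq hpq)
  rw [Finset.erase_insert hdC] at hch'
  exact ⟨a, b, hxa, hdb.symm, hch'.symm⟩

/-- If two disjoint lobes cannot be enlarged and no third lobe is disjoint from both, what remains
is a chain from the attachment of one of them to the root. -/
theorem IsLobe.isChain_sdiff {T C₁ C₂ : Finset V} {y d₁ d₂ : V} (hy : y ∈ T)
    (hT : ∀ w ∈ T, G.Conn T w y) (h₁ : G.IsLobe T y d₁ C₁) (h₂ : G.IsLobe T y d₂ C₂)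
    (hd : Disjoint C₁ C₂)
    (hmax : ∀ d C, G.IsLobe T y d C → Disjoint C₁ C → C.card ≤ C₂.card)
    (hthird : ∀ d C, G.IsLobe T y d C → Disjoint C C₁ → Disjoint C C₂ → False) :
    G.IsChain ((T \ C₁) \ C₂) d₁ y := by
  classical
  have hd12 := h₁.att_notMem_of_disjoint hT h₂ hd
  have hQ : ∀ {w}, w ∈ (T \ C₁) \ C₂ ↔ w ∈ T ∧ w ∉ C₁ ∧ w ∉ C₂ := by
    intro w
    simp [and_assoc]
  have hconn : ∀ w ∈ (T \ C₁) \ C₂, G.Conn ((T \ C₁) \ C₂) w y := by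
    intro w hw
    rw [hQ] at hw
    refine Conn.sdiff_of_attached (d := d₂) ?_ (Conn.sdiff_of_attached (d := d₁) h₁.att
      (hT w hw.1) hw.2.1 h₁.root_notMem) hw.2.2 h₂.root_notMem
    exact fun p hp q hq hqC => h₂.att p hp q (Finset.mem_sdiff.1 hq).1 hqC
  refine ⟨hQ.2 ⟨h₁.att_mem, h₁.att_notMem, hd12⟩, hQ.2 ⟨hy, h₁.root_notMem, h₂.root_notMem⟩,
    hconn, ?_⟩
  intro v hv w hw hne
  by_contra! hcon
  have hU := IsLobe.of_not_conn hv hw hne hcon.2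
  have hd₁U : d₁ ∉ (((T \ C₁) \ C₂).erase v).filter (G.Conn (((T \ C₁) \ C₂).erase v) w) :=
    fun h => hcon.1 (Finset.mem_filter.1 h).2
  generalize (((T \ C₁) \ C₂).erase v).filter (G.Conn (((T \ C₁) \ C₂).erase v) w) = U at hU hd₁U
  have hUQ : ∀ u ∈ U, u ∈ T ∧ u ∉ C₁ ∧ u ∉ C₂ := fun u hu => hQ.1 (hU.subset hu)
  have hvQ := hQ.1 hv
  have hU1 : Disjoint U C₁ := Finset.disjoint_left.2 fun u hu => (hUQ u hu).2.1
  have hU2 : Disjoint U C₂ := Finset.disjoint_left.2 fun u hu => (hUQ u hu).2.2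
  have hatt : ∀ u ∈ U, ∀ z ∈ T, z ∉ U → z ∉ C₂ → G.Adj u z → z = v := by
    intro u hu z hz hzU hzC huz
    by_cases hz1 : z ∈ C₁
    · exact absurd (h₁.att z hz1 u (hUQ u hu).1 (hUQ u hu).2.1 huz.symm ▸ hu) hd₁U
    · exact hU.att u hu z (hQ.2 ⟨hz, hz1, hzC⟩) hzU huz
  -- A piece `U` cut off in the remainder either contains `d₂`, so that `U ∪ C₂` is a larger lobe,
  -- or is itself a third lobe.
  by_cases hd₂U : d₂ ∈ U
  · obtain ⟨b, hb, hbd⟩ := h₂.exists_adj hT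
    have hto : ∀ u ∈ U ∪ C₂, G.Conn (U ∪ C₂) u d₂ := by
      intro u hu
      rcases Finset.mem_union.1 hu with hu | hu
      · exact (hU.conn u hu d₂ hd₂U).mono Finset.subset_union_left
      · exact ((h₂.conn u hu b hb).mono Finset.subset_union_right).trans
          (Conn.single hbd (Finset.mem_union_right _ hb) (Finset.mem_union_left _ hd₂U))
    have hL : G.IsLobe T y v (U ∪ C₂) := by
      refine ⟨Finset.union_subset (fun u hu => (hUQ u hu).1) h₂.subset, hvQ.1, ?_, ?_, ?_, ?_, ?_⟩
      · simp [hU.att_notMem, hvQ.2.2]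
      · simp [hU.root_notMem, h₂.root_notMem]
      · exact ⟨b, Finset.mem_union_right _ hb⟩
      · intro u hu z hz hzn huz
        rw [Finset.mem_union, not_or] at hzn
        rcases Finset.mem_union.1 hu with hu | hu
        · exact hatt u hu z hz hzn.1 hzn.2 huz
        · exact absurd (h₂.att u hu z hz hzn.2 huz ▸ hd₂U) hzn.1
      · exact fun u hu w hw => (hto u hu).trans (hto w hw).symm
    have := hmax v _ hL (Finset.disjoint_union_right.2 ⟨hU1.symm, hd⟩)
    rw [Finset.card_union_of_disjoint hU2] at this
    have := hU.nonempty.card_pos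
    omega
  · refine hthird v U ⟨fun u hu => (hUQ u hu).1, hvQ.1, hU.att_notMem, hU.root_notMem,
      hU.nonempty, ?_, hU.conn⟩ hU1 hU2
    intro u hu z hz hzU huz
    by_cases hz2 : z ∈ C₂
    · exact absurd (h₂.att z hz2 u (hUQ u hu).1 (hUQ u hu).2.2 huz.symm ▸ hu) hd₂U
    · exact hatt u hu z hz hzU hz2 huz

/-- The cyclic arrangement `x - A₁ - Q - A₂ - x` of chains around a terminal `x` whose deletion
does not leave a chain; the root `y` lies in `Q`. -/
structure IsArms (G : SimpleGraph V) (x y : V) (A₁ A₂ Q : Finset V) (a₁ b₁ d₁ a₂ b₂ d₂ : V) :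
    Prop where
  disj : Disjoint A₁ A₂
  disj₁ : Disjoint A₁ Q
  disj₂ : Disjoint A₂ Q
  chain₁ : G.IsChain A₁ a₁ b₁
  chain₂ : G.IsChain A₂ a₂ b₂
  core₁ : G.IsChain Q d₁ y
  core₂ : G.IsChain Q d₂ y
  start₁ : G.Adj x a₁
  start₂ : G.Adj x a₂
  end₁ : G.Adj b₁ d₁
  end₂ : G.Adj b₂ d₂
  not_adj : ∀ u ∈ A₁, ∀ w ∈ A₂, ¬ G.Adj u w
  att₁ : ∀ u ∈ A₁, ∀ w ∈ Q, G.Adj u w → w = d₁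
  att₂ : ∀ u ∈ A₂, ∀ w ∈ Q, G.Adj u w → w = d₂

theorem IsArms.swap {x y : V} {A₁ A₂ Q : Finset V} {a₁ b₁ d₁ a₂ b₂ d₂ : V}
    (h : G.IsArms x y A₁ A₂ Q a₁ b₁ d₁ a₂ b₂ d₂) : G.IsArms x y A₂ A₁ Q a₂ b₂ d₂ a₁ b₁ d₁ :=
  ⟨h.disj.symm, h.disj₂, h.disj₁, h.chain₂, h.chain₁, h.core₂, h.core₁, h.start₂, h.start₁,
    h.end₂, h.end₁, fun u hu w hw h' => h.not_adj w hw u hu h'.symm, h.att₂, h.att₁⟩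

/-- Both attachments of `C₁` see a clique in `C₁`, because each has a further neighbour with no
neighbour in `C₁`: for `x` one in `C₂`, for `d₁` one in `C₂` if `d₁ = d₂`, and otherwise one in the
remainder on a walk towards `d₂`. -/
theorem IsLobe.exists_isChain_of_disjoint (hG : G.IsClawFree) {S C₁ C₂ : Finset V} {x y d₁ d₂ : V}
    (h : G.IsChain S x y) (h₁ : G.IsLobe (S.erase x) y d₁ C₁) (h₂ : G.IsLobe (S.erase x) y d₂ C₂)
    (hd : Disjoint C₁ C₂) (hQ : G.IsChain (((S.erase x) \ C₁) \ C₂) d₁ y) :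
    ∃ a b, G.Adj x a ∧ G.Adj b d₁ ∧ G.IsChain C₁ a b := by
  have hT := h.conn_erase_left
  refine h₁.exists_isChain h ?_ ?_
  · obtain ⟨r, hr, hxr⟩ := h.lobe_exists_adj h₂
    intro p hp q hq hxp hxq hpq
    have hne : ∀ t ∈ C₁, t ≠ r := fun t ht h => Finset.disjoint_left.1 hd ht (h ▸ hr)
    rcases hG.adj_of_adj hxp hxq hxr hpq (hne p hp) (hne q hq) with h | h | h
    · exact h
    · exact absurd h (h₁.not_adj_of_disjoint hT h₂ hd hp hr)
    · exact absurd h (h₁.not_adj_of_disjoint hT h₂ hd hq hr)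
  · have hr : ∃ r, G.Adj d₁ r ∧ r ∉ C₁ ∧ ∀ t ∈ C₁, ¬ G.Adj t r := by
      by_cases hdd : d₁ = d₂
      · obtain ⟨b, hb, hbd⟩ := h₂.exists_adj hT
        exact ⟨b, hdd ▸ hbd.symm, Finset.disjoint_right.1 hd hb,
          fun t ht => h₁.not_adj_of_disjoint hT h₂ hd ht hb⟩
      · have hd₂ : d₂ ∈ ((S.erase x) \ C₁) \ C₂ := by
          simp only [Finset.mem_sdiff]
          exact ⟨⟨h₂.att_mem, h₂.att_notMem_of_disjoint hT h₁ hd.symm⟩, h₂.att_notMem⟩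
        obtain ⟨a, b, ha, hb, hab, -, hbQ⟩ := ((hQ.conn d₁ hQ.left_mem).trans
          (hQ.conn d₂ hd₂).symm).exists_exit (P := {d₁}) (by simp) (by simpa using Ne.symm hdd)
        rw [Finset.mem_singleton] at ha hb
        subst ha
        simp only [Finset.mem_sdiff] at hbQ
        exact ⟨b, hab, hbQ.1.2, fun t ht htb => hb (h₁.att t ht b hbQ.1.1 hbQ.1.2 htb)⟩
    obtain ⟨r, hdr, hrC, hrn⟩ := hr
    intro p hp q hq hdp hdq hpq
    have hne : ∀ t ∈ C₁, t ≠ r := fun t ht h => hrC (h ▸ ht)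
    rcases hG.adj_of_adj hdp hdq hdr hpq (hne p hp) (hne q hq) with h | h | h
    · exact h
    · exact absurd h (hrn p hp)
    · exact absurd h (hrn q hq)

theorem IsChain.erase_left_or_arms (hG : G.IsClawFree) {S : Finset V} {x y : V}
    (h : G.IsChain S x y) (hxy : x ≠ y) :
    (∃ x' ∈ S.erase x, G.Adj x x' ∧ G.IsChain (S.erase x) x' y) ∨
    ∃ A₁ A₂ Q a₁ b₁ d₁ a₂ b₂ d₂, S.erase x = A₁ ∪ A₂ ∪ Q ∧
      G.IsArms x y A₁ A₂ Q a₁ b₁ d₁ a₂ b₂ d₂ := by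
  classical
  refine (h.erase_left_or_lobes hxy).imp id ?_
  rintro ⟨d₁', C₁', d₂', C₂', h₁', h₂', hd'⟩
  have hT := h.conn_erase_left
  have hy : y ∈ S.erase x := Finset.mem_erase.2 ⟨hxy.symm, h.right_mem⟩
  set T := S.erase x with hTdef
  have hmem : ∀ d d' C C', G.IsLobe T y d C → G.IsLobe T y d' C' → Disjoint C C' →
      (C, C') ∈ (T.powerset ×ˢ T.powerset).filter fun C : Finset V × Finset V =>
        (∃ d, G.IsLobe T y d C.1) ∧ (∃ d, G.IsLobe T y d C.2) ∧ Disjoint C.1 C.2 :=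
    fun d d' C C' hC hC' hd => Finset.mem_filter.2
      ⟨Finset.mk_mem_product (Finset.mem_powerset.2 hC.subset) (Finset.mem_powerset.2 hC'.subset),
        ⟨d, hC⟩, ⟨d', hC'⟩, hd⟩
  -- Maximal total size makes each lobe maximal given the other, so the remainder is a chain from
  -- either attachment.
  obtain ⟨⟨C₁, C₂⟩, hC, hmax⟩ := Finset.exists_max_image _
    (fun C : Finset V × Finset V => C.1.card + C.2.card) ⟨_, hmem _ _ _ _ h₁' h₂' hd'⟩
  obtain ⟨-, ⟨d₁, h₁⟩, ⟨d₂, h₂⟩, hd⟩ := Finset.mem_filter.1 hC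
  dsimp only at h₁ h₂ hd
  have hmax' : ∀ d d' C C', G.IsLobe T y d C → G.IsLobe T y d' C' → Disjoint C C' →
      C.card + C'.card ≤ C₁.card + C₂.card := fun d d' C C' hC hC' hCC =>
    hmax _ (hmem _ _ _ _ hC hC' hCC)
  have hthird : ∀ d C, G.IsLobe T y d C → Disjoint C C₁ → Disjoint C C₂ → False := by
    intro d C h₃ hd1 hd2
    obtain ⟨p, hp, hxp⟩ := h.lobe_exists_adj h₁
    obtain ⟨q, hq, hxq⟩ := h.lobe_exists_adj h₂
    obtain ⟨r, hr, hxr⟩ := h.lobe_exists_adj h₃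
    rcases hG.adj_of_adj hxp hxq hxr (fun h => Finset.disjoint_left.1 hd hp (h ▸ hq))
      (fun h => Finset.disjoint_right.1 hd1 hp (h ▸ hr))
      (fun h => Finset.disjoint_right.1 hd2 hq (h ▸ hr)) with h | h | h
    · exact h₁.not_adj_of_disjoint hT h₂ hd hp hq h
    · exact h₁.not_adj_of_disjoint hT h₃ hd1.symm hp hr h
    · exact h₂.not_adj_of_disjoint hT h₃ hd2.symm hq hr h
  have hQ₁ := h₁.isChain_sdiff hy hT h₂ hd
    (fun d C hC hdC => by have := hmax' _ _ _ _ h₁ hC hdC; omega) hthird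
  have hQ₂ := h₂.isChain_sdiff hy hT h₁ hd.symm
    (fun d C hC hdC => by have := hmax' _ _ _ _ hC h₂ hdC.symm; omega)
    (fun d C hC h1 h2 => hthird d C hC h2 h1)
  obtain ⟨a₁, b₁, hxa₁, hbd₁, hc₁⟩ := h₁.exists_isChain_of_disjoint hG h h₂ hd hQ₁
  obtain ⟨a₂, b₂, hxa₂, hbd₂, hc₂⟩ := h₂.exists_isChain_of_disjoint hG h h₁ hd.symm hQ₂
  refine ⟨C₁, C₂, (T \ C₁) \ C₂, a₁, b₁, d₁, a₂, b₂, d₂, ?_, hd, ?_, ?_, hc₁, hc₂, hQ₁, ?_, hxa₁,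
    hxa₂, hbd₁, hbd₂, fun u hu w hw => h₁.not_adj_of_disjoint hT h₂ hd hu hw, ?_, ?_⟩
  · ext z
    have := @h₁.subset z
    have := @h₂.subset z
    simp only [Finset.mem_union, Finset.mem_sdiff]
    tauto
  · exact Finset.disjoint_left.2 fun z hz => by simp [hz]
  · exact Finset.disjoint_left.2 fun z hz => by simp [hz]
  · rwa [sdiff_right_comm] at hQ₂
  · intro u hu w hw
    simp only [Finset.mem_sdiff] at hw
    exact h₁.att u hu w hw.1.1 hw.1.2
  · intro u hu w hw
    simp only [Finset.mem_sdiff] at hw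
    exact h₂.att u hu w hw.1.1 hw.2

end Arms

end SimpleGraph
namespace SimpleGraph

/-! ### Splitting chains by residues, and factors into 3-vertex paths -/

section TripleFactor

variable {V : Type*} [DecidableEq V] {G H : SimpleGraph V}

/-- `S` can be partitioned into vertex sets of 3-vertex paths of `H`. -/
inductive TripleFactor (H : SimpleGraph V) : Finset V → Prop
  | empty : TripleFactor H ∅
  | step {S : Finset V} {a b c : V} (hab : H.Adj a b) (hbc : H.Adj b c) (hac : a ≠ c)
      (ha : a ∉ S) (hb : b ∉ S) (hc : c ∉ S) (h : TripleFactor H S) :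
      TripleFactor H (insert a (insert b (insert c S)))

namespace TripleFactor

theorem mono {H' : SimpleGraph V} {S : Finset V} (h : TripleFactor H S)
    (hH : ∀ u ∈ S, ∀ v ∈ S, H.Adj u v → H'.Adj u v) : TripleFactor H' S := by
  induction h with
  | empty => exact empty
  | step hab hbc hac ha hb hc _ ih =>
    refine step (hH _ (by simp) _ (by simp) hab) (hH _ (by simp) _ (by simp) hbc) hac ha hb hc
      (ih fun u hu v hv => hH u (by simp [hu]) v (by simp [hv]))

theorem union {B C : Finset V} (hB : TripleFactor H B) (hC : TripleFactor H C)
    (hd : Disjoint B C) : TripleFactor H (B ∪ C) := by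
  induction hB with
  | empty => simpa using hC
  | step hab hbc hac ha hb hc _ ih =>
    simp only [Finset.disjoint_insert_left] at hd
    obtain ⟨h1, h2, h3, h4⟩ := hd
    simp only [Finset.insert_union]
    exact step hab hbc hac (by simp [ha, h1]) (by simp [hb, h2]) (by simp [hc, h3]) (ih h4)

theorem of_deleteEdges {S : Finset V} {e : Set (Sym2 V)} (h : TripleFactor (G.deleteEdges e) S) :
    TripleFactor G S := h.mono fun _ _ _ _ h => (deleteEdges_adj.1 h).1

theorem deleteEdges {S : Finset V} {x y : V} (h : TripleFactor G S) (hxy : x ∉ S ∨ y ∉ S) :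
    TripleFactor (G.deleteEdges {s(x, y)}) S := by
  refine h.mono fun u hu v hv h => deleteEdges_adj.2 ⟨h, fun he => ?_⟩
  rw [Set.mem_singleton_iff, Sym2.eq_iff] at he
  rcases he with ⟨rfl, rfl⟩ | ⟨rfl, rfl⟩ <;> tauto

end TripleFactor

/-- The neighbours of `d₁` in `Q` form a clique, `b₁` being the third tip of a would-be claw; so
`d₁` can be moved from the core to the first arm. If `d₁ = y`, the core loses its terminal and gets
a new one, `t`. -/
theorem IsArms.core_erase (hG : G.IsClawFree) {x y : V} {A₁ A₂ Q : Finset V}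
    {a₁ b₁ d₁ a₂ b₂ d₂ : V} (h : G.IsArms x y A₁ A₂ Q a₁ b₁ d₁ a₂ b₂ d₂) (hd : d₁ ≠ d₂) :
    ∃ t, G.IsChain (Q.erase d₁) d₂ t ∧ (t = y ∨ d₁ = y) := by
  have hcl : ∀ p ∈ Q, ∀ q ∈ Q, G.Adj d₁ p → G.Adj d₁ q → p ≠ q → G.Adj p q := by
    intro p hp q hq hdp hdq hpq
    have hb : ∀ r ∈ Q, G.Adj d₁ r → ¬ G.Adj b₁ r := fun r hr hdr hbr =>
      hdr.ne (h.att₁ b₁ h.chain₁.right_mem r hr hbr).symm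
    have hne : ∀ r ∈ Q, b₁ ≠ r := fun r hr h' =>
      Finset.disjoint_left.1 h.disj₁ h.chain₁.right_mem (h' ▸ hr)
    rcases hG.adj_of_adj h.end₁.symm hdp hdq (hne p hp) (hne q hq) hpq with h' | h' | h'
    · exact absurd h' (hb p hp hdp)
    · exact absurd h' (hb q hq hdq)
    · exact h'
  by_cases hy : d₁ = y
  · subst hy
    obtain ⟨q, -, -, hq⟩ := h.core₂.symm.erase_left_of_clique hd
      fun p hp q hq h1 h2 h3 _ _ => hcl p hp q hq h1 h2 h3
    exact ⟨q, hq.symm, Or.inr rfl⟩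
  · exact ⟨y, h.core₂.erase_of_clique hd.symm (Ne.symm hy) hcl, Or.inl rfl⟩

/-- A further vertex would give `d` a neighbour in `Q`, and with `b₁` and `b₂` a claw at `d`. -/
theorem IsArms.core_eq (hG : G.IsClawFree) {x y : V} {A₁ A₂ Q : Finset V}
    {a₁ b₁ d a₂ b₂ : V} (h : G.IsArms x y A₁ A₂ Q a₁ b₁ d a₂ b₂ d) : Q = {d} := by
  refine Finset.eq_singleton_iff_unique_mem.2 ⟨h.core₁.left_mem, fun w hw => ?_⟩
  by_contra hne
  obtain ⟨c, r, hc, hr, hcr, -, hrQ⟩ := ((h.core₁.conn d h.core₁.left_mem).trans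
    (h.core₁.conn w hw).symm).exists_exit (P := {d}) (by simp) (by simpa using hne)
  rw [Finset.mem_singleton] at hc hr
  subst hc
  rcases hG.adj_of_adj h.end₁.symm h.end₂.symm hcr
    (fun h' => Finset.disjoint_left.1 h.disj h.chain₁.right_mem (h' ▸ h.chain₂.right_mem))
    (fun h' => Finset.disjoint_left.1 h.disj₁ h.chain₁.right_mem (h' ▸ hrQ))
    (fun h' => Finset.disjoint_left.1 h.disj₂ h.chain₂.right_mem (h' ▸ hrQ)) with h' | h' | h'
  · exact h.not_adj _ h.chain₁.right_mem _ h.chain₂.right_mem h'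
  · exact hr (h.att₁ _ h.chain₁.right_mem _ hrQ h')
  · exact hr (h.att₂ _ h.chain₂.right_mem _ hrQ h')

/-- `S` splits into two chains, the first with `3m` vertices, neither of which contains both `x` and
`y` except possibly as its two terminals. -/
def HasChainSplit (G : SimpleGraph V) (S : Finset V) (x y : V) : Prop :=
  ∃ B C p q r t, G.IsChain B p q ∧ G.IsChain C r t ∧ S = B ∪ C ∧ Disjoint B C ∧ 3 ∣ B.card ∧
    (x ∉ B ∨ y ∉ B) ∧ (x ∉ C ∨ y ∉ C ∨ (r = x ∧ t = y))

theorem notMem_union₃ {z : V} {A₁ A₂ Q : Finset V} (hz : z ∉ A₁ ∪ A₂ ∪ Q) :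
    z ∉ A₁ ∧ z ∉ A₂ ∧ z ∉ Q := by
  simpa [and_assoc] using hz

theorem union_insert_regroup (x y z d : V) (A B C : Finset V) :
    insert x (insert y (insert z (A ∪ B ∪ insert d C))) =
      insert d A ∪ insert x (insert y (insert z (B ∪ C))) := by
  ext w
  simp only [Finset.mem_union, Finset.mem_insert]
  tauto

theorem IsArms.card_union {x y : V} {A₁ A₂ Q : Finset V} {a₁ b₁ d₁ a₂ b₂ d₂ : V}
    (hA : G.IsArms x y A₁ A₂ Q a₁ b₁ d₁ a₂ b₂ d₂) :
    (A₁ ∪ A₂ ∪ Q).card = A₁.card + A₂.card + Q.card := by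
  rw [Finset.card_union_of_disjoint (Finset.disjoint_union_left.2 ⟨hA.disj₁, hA.disj₂⟩),
    Finset.card_union_of_disjoint hA.disj]

/-- The part of size divisible by 3 is `A₁`, `A₁ + x` or `A₁ + x + A₂`, according to `|A₁|` mod 3
being 0, 2 or 1. The excluded residues are covered by swapping the arms. -/
theorem IsArms.hasChainSplit₁ {S : Finset V} {x y : V} {A₁ A₂ Q : Finset V}
    {a₁ b₁ d₁ a₂ b₂ d₂ : V} (hA : G.IsArms x y A₁ A₂ Q a₁ b₁ d₁ a₂ b₂ d₂)
    (hS : S = insert x (A₁ ∪ A₂ ∪ Q)) (hx : x ∉ A₁ ∪ A₂ ∪ Q) (h3 : 3 ∣ S.card)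
    (hmod : A₁.card % 3 ≠ 1 ∨ A₂.card % 3 = 1) : HasChainSplit G S x y := by
  have hcard := hA.card_union
  have cS := Finset.card_insert_of_notMem hx
  rw [← hS] at cS
  obtain ⟨hx1, hx2, hx3⟩ := notMem_union₃ hx
  have cx1 : (insert x A₁).card = A₁.card + 1 := Finset.card_insert_of_notMem hx1
  have cx2 : (insert x A₂).card = A₂.card + 1 := Finset.card_insert_of_notMem hx2
  have h2Q := hA.chain₂.append hA.core₂ hA.disj₂ hA.end₂
  have hx2Q : x ∉ A₂ ∪ Q := by simp [hx2, hx3]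
  have hyQ := hA.core₁.right_mem
  have hy1 : y ∉ A₁ := Finset.disjoint_right.1 hA.disj₁ hyQ
  have hy2 : y ∉ A₂ := Finset.disjoint_right.1 hA.disj₂ hyQ
  have hyx : y ≠ x := fun h => hx3 (h ▸ hyQ)
  by_cases m0 : A₁.card % 3 = 0
  · refine ⟨_, _, _, _, _, _, hA.chain₁, h2Q.cons hx2Q hA.start₂, ?_, ?_, by omega, Or.inl hx1,
      Or.inr (Or.inr ⟨rfl, rfl⟩)⟩
    · rw [hS, Finset.union_insert, Finset.union_assoc]
    · simp [hx1, hA.disj, hA.disj₁]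
  by_cases m2 : A₁.card % 3 = 2
  · refine ⟨_, _, _, _, _, _, hA.chain₁.cons hx1 hA.start₁, h2Q, ?_, ?_, by omega,
      Or.inr (by simp [hyx, hy1]), Or.inl hx2Q⟩
    · rw [hS, Finset.insert_union, Finset.union_assoc]
    · simp [hx2, hx3, hA.disj, hA.disj₁]
  · have hd : Disjoint A₁ (insert x A₂) := by simp [hx1, hA.disj]
    have cc := Finset.card_union_of_disjoint hd
    refine ⟨_, _, _, _, _, _, hA.chain₁.symm.append (hA.chain₂.cons hx2 hA.start₂) hd
      hA.start₁.symm, hA.core₁, ?_, ?_, by omega, Or.inr (by simp [hyx, hy1, hy2]), Or.inl hx3⟩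
    · rw [hS, Finset.union_insert, Finset.insert_union]
    · simp [hx3, hA.disj₁, hA.disj₂]

/-- Here the part is `A₁`, `x + x' + A₁` or `x + A₁` for residues 0, 1, 2; the last is a chain
thanks to the edge `x a₁`. -/
theorem IsArms.hasChainSplit₂ {S : Finset V} {x x' y : V} {A₁ A₂ Q : Finset V}
    {a₁ b₁ d₁ a₂ b₂ d₂ : V} (hA : G.IsArms x' y A₁ A₂ Q a₁ b₁ d₁ a₂ b₂ d₂)
    (hS : S = insert x (insert x' (A₁ ∪ A₂ ∪ Q))) (hx : x ∉ A₁ ∪ A₂ ∪ Q)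
    (hx' : x' ∉ A₁ ∪ A₂ ∪ Q) (hxx' : G.Adj x x') (hxa : G.Adj x a₁) (h3 : 3 ∣ S.card) :
    HasChainSplit G S x y := by
  have hne := hxx'.ne
  have hcard := hA.card_union
  have cS' := Finset.card_insert_of_notMem hx'
  have cS := Finset.card_insert_of_notMem (a := x) (s := insert x' (A₁ ∪ A₂ ∪ Q))
    (by simpa [hne] using hx)
  rw [← hS] at cS
  obtain ⟨hx1, hx2, hx3⟩ := notMem_union₃ hx
  obtain ⟨hx1', hx2', hx3'⟩ := notMem_union₃ hx'
  have hxi : x ∉ insert x' A₁ := by simp [hne, hx1]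
  have cx1 : (insert x A₁).card = A₁.card + 1 := Finset.card_insert_of_notMem hx1
  have cx2 : (insert x' A₁).card = A₁.card + 1 := Finset.card_insert_of_notMem hx1'
  have cx3 := Finset.card_insert_of_notMem hxi
  have h2Q := (hA.chain₂.append hA.core₂ hA.disj₂ hA.end₂)
  have hx2Q : x ∉ A₂ ∪ Q := by simp [hx2, hx3]
  have hx2Q' : x' ∉ A₂ ∪ Q := by simp [hx2', hx3']
  have hyQ := hA.core₁.right_mem
  have hy1 : y ∉ A₁ := Finset.disjoint_right.1 hA.disj₁ hyQ
  have hyx : y ≠ x := fun h => hx3 (h ▸ hyQ)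
  have hyx' : y ≠ x' := fun h => hx3' (h ▸ hyQ)
  have m : A₁.card % 3 = 0 ∨ A₁.card % 3 = 1 ∨ A₁.card % 3 = 2 := by omega
  rcases m with m | m | m
  · refine ⟨_, _, _, _, _, _, hA.chain₁, (h2Q.cons hx2Q' hA.start₂).cons
      (by simp [hne, hx2, hx3]) hxx', ?_, ?_, by omega, Or.inl hx1, Or.inr (Or.inr ⟨rfl, rfl⟩)⟩
    · rw [hS, Finset.union_insert, Finset.union_insert, Finset.union_assoc]
    · simp [hx1, hx1', hA.disj, hA.disj₁]
  · refine ⟨_, _, _, _, _, _, (hA.chain₁.cons hx1' hA.start₁).cons hxi hxx', h2Q, ?_, ?_,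
      by omega, Or.inr (by simp [hyx, hyx', hy1]), Or.inl hx2Q⟩
    · rw [hS, Finset.insert_union, Finset.insert_union, Finset.union_assoc]
    · simp [hx2, hx3, hx2', hx3', hA.disj, hA.disj₁]
  · refine ⟨_, _, _, _, _, _, hA.chain₁.cons hx1 hxa, h2Q.cons hx2Q' hA.start₂, ?_, ?_, by omega,
      Or.inr (by simp [hyx, hy1]), Or.inl (by simp [hne, hx2, hx3])⟩
    · rw [hS, Finset.insert_union, Finset.union_insert, Finset.union_assoc]
    · simp [hne.symm, hx2, hx3, hx1', hA.disj, hA.disj₁]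

/-- Residue 0 uses `A₁`; residue 1 uses `x + x' + A₁`, through the edge `x' a₁`. For residue 2,
either `d₁ ≠ d₂` and `A₁ + d₁` works, or the core is a single vertex and the count forces `3 ∣
|A₂|`. -/
theorem IsArms.hasChainSplit₃ (hG : G.IsClawFree) {S : Finset V} {x x' x'' y : V}
    {A₁ A₂ Q : Finset V} {a₁ b₁ d₁ a₂ b₂ d₂ : V}
    (hA : G.IsArms x'' y A₁ A₂ Q a₁ b₁ d₁ a₂ b₂ d₂)
    (hS : S = insert x (insert x' (insert x'' (A₁ ∪ A₂ ∪ Q)))) (hx : x ∉ A₁ ∪ A₂ ∪ Q)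
    (hx' : x' ∉ A₁ ∪ A₂ ∪ Q) (hx'' : x'' ∉ A₁ ∪ A₂ ∪ Q) (hxx' : G.Adj x x')
    (hxx'' : G.Adj x' x'') (hne'' : x ≠ x'') (hxa : G.Adj x' a₁) (h3 : 3 ∣ S.card) :
    HasChainSplit G S x y := by
  have hne := hxx'.ne
  have hne' := hxx''.ne
  have hcard := hA.card_union
  have cS'' := Finset.card_insert_of_notMem hx''
  have cS' := Finset.card_insert_of_notMem (a := x') (s := insert x'' (A₁ ∪ A₂ ∪ Q))
    (by simpa [hne'] using hx')
  have cS := Finset.card_insert_of_notMem (a := x) (s := insert x' (insert x'' (A₁ ∪ A₂ ∪ Q)))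
    (by simpa [hne, hne''] using hx)
  rw [← hS] at cS
  obtain ⟨hx1, hx2, hx3⟩ := notMem_union₃ hx
  obtain ⟨hx1', hx2', hx3'⟩ := notMem_union₃ hx'
  obtain ⟨hx1'', hx2'', hx3''⟩ := notMem_union₃ hx''
  have hxi : x ∉ insert x' A₁ := by simp [hne, hx1]
  have cx2 : (insert x' A₁).card = A₁.card + 1 := Finset.card_insert_of_notMem hx1'
  have cx3 := Finset.card_insert_of_notMem hxi
  have tail : ∀ {B : Finset V} {a b : V}, G.IsChain B a b → G.Adj x'' a → x ∉ B → x' ∉ B →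
      x'' ∉ B → G.IsChain (insert x (insert x' (insert x'' B))) x b := fun hB ha h h' h'' =>
    ((hB.cons h'' ha).cons (by simp [hne', h']) hxx'').cons (by simp [hne, hne'', h]) hxx'
  have h2Q := hA.chain₂.append hA.core₂ hA.disj₂ hA.end₂
  have hyQ := hA.core₁.right_mem
  have hy1 : y ∉ A₁ := Finset.disjoint_right.1 hA.disj₁ hyQ
  have hyx : y ≠ x := fun h => hx3 (h ▸ hyQ)
  have hyx' : y ≠ x' := fun h => hx3' (h ▸ hyQ)
  have m : A₁.card % 3 = 0 ∨ A₁.card % 3 = 1 ∨ A₁.card % 3 = 2 := by omega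
  rcases m with m | m | m
  · refine ⟨_, _, _, _, _, _, hA.chain₁, tail h2Q hA.start₂ (by simp [hx2, hx3])
      (by simp [hx2', hx3']) (by simp [hx2'', hx3'']), ?_, ?_, by omega, Or.inl hx1,
      Or.inr (Or.inr ⟨rfl, rfl⟩)⟩
    · rw [hS, Finset.union_insert, Finset.union_insert, Finset.union_insert, Finset.union_assoc]
    · simp [hx1, hx1', hx1'', hA.disj, hA.disj₁]
  · refine ⟨_, _, _, _, _, _, (hA.chain₁.cons hx1' hxa).cons hxi hxx',
      h2Q.cons (x := x'') (by simp [hx2'', hx3'']) hA.start₂, ?_, ?_, by omega,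
      Or.inr (by simp [hyx, hyx', hy1]), Or.inl (by simp [hne'', hx2, hx3])⟩
    · rw [hS, Finset.insert_union, Finset.insert_union, Finset.union_insert, Finset.union_assoc]
    · simp [hx1'', hne''.symm, hne'.symm, hx2, hx3, hx2', hx3', hA.disj, hA.disj₁]
  · by_cases hd : d₁ = d₂
    · subst hd
      have cQ : Q.card = 1 := by rw [hA.core_eq hG, Finset.card_singleton]
      refine ⟨_, _, _, _, _, _, hA.chain₂, tail (hA.chain₁.append hA.core₁ hA.disj₁ hA.end₁)
        hA.start₁ (by simp [hx1, hx3]) (by simp [hx1', hx3']) (by simp [hx1'', hx3'']), ?_, ?_,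
        by omega, Or.inl hx2, Or.inr (Or.inr ⟨rfl, rfl⟩)⟩
      · rw [hS, Finset.union_insert, Finset.union_insert, Finset.union_insert, Finset.union_assoc,
          Finset.union_left_comm]
      · simp [hx2, hx2', hx2'', hA.disj.symm, hA.disj₂]
    · obtain ⟨t, ht, hty⟩ := hA.core_erase hG hd
      have hdQ := hA.core₁.left_mem
      have hdA : d₁ ∉ A₁ := Finset.disjoint_right.1 hA.disj₁ hdQ
      have hdA2 : d₁ ∉ A₂ := Finset.disjoint_right.1 hA.disj₂ hdQ
      have cd := Finset.card_insert_of_notMem hdA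
      have hdx : x ≠ d₁ := fun h => hx3 (h ▸ hdQ)
      have hdx' : d₁ ≠ x' := fun h => hx3' (h ▸ hdQ)
      have hdx'' : d₁ ≠ x'' := fun h => hx3'' (h ▸ hdQ)
      have hd2 := hA.disj₂.mono_right (Finset.erase_subset d₁ Q)
      have hd1 := hA.disj₁.mono_right (Finset.erase_subset d₁ Q)
      refine ⟨_, _, _, _, _, _, hA.chain₁.symm.cons hdA hA.end₁.symm,
        tail (hA.chain₂.append ht hd2 hA.end₂) hA.start₂ (by simp [hx2, hx3]) (by simp [hx2', hx3'])
        (by simp [hx2'', hx3'']), ?_, ?_, by omega, Or.inl (by simp [hdx, hx1]), ?_⟩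
      · exact hS.trans (Eq.trans (by rw [Finset.insert_erase hdQ])
          (union_insert_regroup x x' x'' d₁ A₁ A₂ (Q.erase d₁)))
      · simp [hdx, hdx'.symm, hdx''.symm, hdA2, hx1, hx1', hx1'', hA.disj, hd1]
      · rcases hty with hty | hty
        · exact Or.inr (Or.inr ⟨rfl, hty⟩)
        · subst hty
          exact Or.inr (Or.inl (by simp [hdx.symm, hdx', hdx'', hdA2]))

/-- A chain of `3m` vertices in a claw-free graph has a factor into 3-vertex paths that avoids the
edge joining the two terminals, if there is one. -/
theorem IsChain.tripleFactor (hG : G.IsClawFree) {S : Finset V} {x y : V} (h : G.IsChain S x y)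
    (h3 : 3 ∣ S.card) : TripleFactor (G.deleteEdges {s(x, y)}) S := by
  induction hn : S.card using Nat.strong_induction_on generalizing S x y with
  | _ n ih =>
  subst hn
  have split : HasChainSplit G S x y → TripleFactor (G.deleteEdges {s(x, y)}) S := by
    rintro ⟨B, C, p, q, r, t, hB, hC, hS, hd, hB3, hxB, hxC⟩
    have hcard := Finset.card_union_of_disjoint hd
    rw [← hS] at hcard
    have hB0 : 0 < B.card := Finset.card_pos.2 ⟨p, hB.left_mem⟩
    have hC0 : 0 < C.card := Finset.card_pos.2 ⟨r, hC.left_mem⟩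
    have fB := ih B.card (by omega) hB hB3 rfl
    have fC := ih C.card (by omega) hC (by omega) rfl
    rw [hS]
    refine (fB.of_deleteEdges.deleteEdges hxB).union ?_ hd
    rcases hxC with hx | hy | ⟨rfl, rfl⟩
    · exact fC.of_deleteEdges.deleteEdges (Or.inl hx)
    · exact fC.of_deleteEdges.deleteEdges (Or.inr hy)
    · exact fC
  have hxy : x ≠ y := by
    rintro rfl
    rw [h.eq_singleton] at h3
    simp at h3
  have c1 : (S.erase x).card + 1 = S.card := Finset.card_erase_add_one h.left_mem
  rcases h.erase_left_or_arms hG hxy with ⟨x', hx', hxx', h'⟩ |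
    ⟨A₁, A₂, Q, a₁, b₁, d₁, a₂, b₂, d₂, hT, hA⟩
  swap
  · have hS : S = insert x (A₁ ∪ A₂ ∪ Q) := by rw [← hT, Finset.insert_erase h.left_mem]
    have hx : x ∉ A₁ ∪ A₂ ∪ Q := by rw [← hT]; simp
    by_cases hmod : A₁.card % 3 ≠ 1 ∨ A₂.card % 3 = 1
    · exact split (hA.hasChainSplit₁ hS hx h3 hmod)
    · rw [Finset.union_comm A₁] at hS hx
      exact split (hA.swap.hasChainSplit₁ hS hx h3 (by omega))
  have hx'y : x' ≠ y := by
    rintro rfl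
    rw [h'.eq_singleton, Finset.card_singleton] at c1
    omega
  have c2 : ((S.erase x).erase x').card + 1 = (S.erase x).card := Finset.card_erase_add_one hx'
  rcases h'.erase_left_or_arms hG hx'y with ⟨x'', hx'', hxx'', h''⟩ |
    ⟨A₁, A₂, Q, a₁, b₁, d₁, a₂, b₂, d₂, hT, hA⟩
  swap
  · have hS : S = insert x (insert x' (A₁ ∪ A₂ ∪ Q)) := by
      rw [← hT, Finset.insert_erase hx', Finset.insert_erase h.left_mem]
    have hx : x ∉ A₁ ∪ A₂ ∪ Q := by rw [← hT]; simp
    have hx' : x' ∉ A₁ ∪ A₂ ∪ Q := by rw [← hT]; simp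
    obtain ⟨hx1, hx2, -⟩ := notMem_union₃ hx
    -- No claw at `x'`: its predecessor `x` is adjacent to the start of one of the two nonadjacent
    -- arms.
    rcases hG.adj_of_adj hxx'.symm hA.start₁ hA.start₂ (fun h => hx1 (h ▸ hA.chain₁.left_mem))
      (fun h => hx2 (h ▸ hA.chain₂.left_mem)) (fun h => Finset.disjoint_left.1 hA.disj
        hA.chain₁.left_mem (h ▸ hA.chain₂.left_mem)) with hh | hh | hh
    · exact split (hA.hasChainSplit₂ hS hx hx' hxx' hh h3)
    · rw [Finset.union_comm A₁] at hS hx hx'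
      exact split (hA.swap.hasChainSplit₂ hS hx hx' hxx' hh h3)
    · exact absurd hh (hA.not_adj _ hA.chain₁.left_mem _ hA.chain₂.left_mem)
  have c3 : (((S.erase x).erase x').erase x'').card + 1 = ((S.erase x).erase x').card :=
    Finset.card_erase_add_one hx''
  have hne'' : x ≠ x'' := fun h => by simp [h] at hx''
  have finish : TripleFactor (G.deleteEdges {s(x, y)}) (((S.erase x).erase x').erase x'') →
      TripleFactor (G.deleteEdges {s(x, y)}) S := by
    intro hf
    have := TripleFactor.step (a := x) (b := x') (c := x'') (deleteEdges_adj.2 ⟨hxx', ?_⟩)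
      (deleteEdges_adj.2 ⟨hxx'', ?_⟩) hne'' (by simp) (by simp) (by simp) hf
    · rwa [Finset.insert_erase hx'', Finset.insert_erase hx', Finset.insert_erase h.left_mem]
        at this
    · rw [Set.mem_singleton_iff, Sym2.eq_iff]
      have := hxx'.ne
      tauto
    · rw [Set.mem_singleton_iff, Sym2.eq_iff]
      have := hxx'.ne
      tauto
  by_cases hx''y : x'' = y
  · subst hx''y
    refine finish ?_
    rw [h''.eq_singleton]
    simpa using TripleFactor.empty
  rcases h''.erase_left_or_arms hG hx''y with ⟨w, -, -, hw⟩ |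
    ⟨A₁, A₂, Q, a₁, b₁, d₁, a₂, b₂, d₂, hT, hA⟩
  · exact finish ((ih _ (by omega) hw (by omega) rfl).of_deleteEdges.deleteEdges
      (Or.inl (by simp)))
  have hS : S = insert x (insert x' (insert x'' (A₁ ∪ A₂ ∪ Q))) := by
    rw [← hT, Finset.insert_erase hx'', Finset.insert_erase hx', Finset.insert_erase h.left_mem]
  have hx : x ∉ A₁ ∪ A₂ ∪ Q := by rw [← hT]; simp
  have hx' : x' ∉ A₁ ∪ A₂ ∪ Q := by rw [← hT]; simp
  have hx'' : x'' ∉ A₁ ∪ A₂ ∪ Q := by rw [← hT]; simp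
  obtain ⟨hx1, hx2, -⟩ := notMem_union₃ hx'
  rcases hG.adj_of_adj hxx''.symm hA.start₁ hA.start₂ (fun h => hx1 (h ▸ hA.chain₁.left_mem))
    (fun h => hx2 (h ▸ hA.chain₂.left_mem)) (fun h => Finset.disjoint_left.1 hA.disj
      hA.chain₁.left_mem (h ▸ hA.chain₂.left_mem)) with hh | hh | hh
  · exact split (hA.hasChainSplit₃ hG hS hx hx' hx'' hxx' hxx'' hne'' hh h3)
  · rw [Finset.union_comm A₁] at hS hx hx' hx''
    exact split (hA.swap.hasChainSplit₃ hG hS hx hx' hx'' hxx' hxx'' hne'' hh h3)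
  · exact absurd hh (hA.not_adj _ hA.chain₁.left_mem _ hA.chain₂.left_mem)

/-- In a claw-free graph every chain has a factor into 3-vertex paths and at most one clique on
one or two vertices. -/
theorem IsChain.exists_clique_tripleFactor (hG : G.IsClawFree) {S : Finset V} {x y : V}
    (h : G.IsChain S x y) :
    ∃ P ⊆ S, P.card = S.card % 3 ∧ (∀ u ∈ P, ∀ v ∈ P, u ≠ v → G.Adj u v) ∧
      TripleFactor G (S \ P) := by
  induction hn : S.card using Nat.strong_induction_on generalizing S x y with
  | _ n ih =>
  subst hn
  by_cases h0 : S.card % 3 = 0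
  · refine ⟨∅, by simp, by simp [h0], by simp, ?_⟩
    rw [Finset.sdiff_empty]
    exact (h.tripleFactor hG (Nat.dvd_of_mod_eq_zero h0)).of_deleteEdges
  have split : ∀ {B C : Finset V} {p q r t : V}, G.IsChain B p q → G.IsChain C r t →
      S = B ∪ C → Disjoint B C → 3 ∣ B.card → ∃ P ⊆ S, P.card = S.card % 3 ∧
        (∀ u ∈ P, ∀ v ∈ P, u ≠ v → G.Adj u v) ∧ TripleFactor G (S \ P) := by
    intro B C p q r t hB hC hS hd hB3
    have hcard := Finset.card_union_of_disjoint hd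
    rw [← hS] at hcard
    have hB0 : 0 < B.card := Finset.card_pos.2 ⟨p, hB.left_mem⟩
    obtain ⟨P, hPC, hP, hcl, hf⟩ := ih C.card (by omega) hC rfl
    refine ⟨P, hPC.trans (hS ▸ Finset.subset_union_right), by omega, hcl, ?_⟩
    rw [hS, Finset.union_sdiff_distrib, Finset.sdiff_eq_self_of_disjoint (hd.mono_right hPC)]
    exact (hB.tripleFactor hG hB3).of_deleteEdges.union hf (hd.mono_right Finset.sdiff_subset)
  have split' : ∀ {B C : Finset V} {p q r t : V}, G.IsChain B p q → G.IsChain C r t →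
      S = B ∪ C → Disjoint B C → 3 ∣ C.card → ∃ P ⊆ S, P.card = S.card % 3 ∧
        (∀ u ∈ P, ∀ v ∈ P, u ≠ v → G.Adj u v) ∧ TripleFactor G (S \ P) :=
    fun hB hC hS hd h3 => split hC hB (by rw [hS, Finset.union_comm]) hd.symm h3
  by_cases hxy : x = y
  · subst hxy
    refine ⟨S, subset_rfl, ?_, ?_, ?_⟩
    · rw [h.eq_singleton, Finset.card_singleton]
    · rw [h.eq_singleton]
      simp +contextual
    · rw [Finset.sdiff_self]
      exact TripleFactor.empty
  have c1 : (S.erase x).card + 1 = S.card := Finset.card_erase_add_one h.left_mem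
  rcases h.erase_left_or_arms hG hxy with ⟨x', hx', hxx', h'⟩ |
    ⟨A₁, A₂, Q, a₁, b₁, d₁, a₂, b₂, d₂, hT, hA⟩
  swap
  · have hS : S = insert x (A₁ ∪ A₂ ∪ Q) := by rw [← hT, Finset.insert_erase h.left_mem]
    have hx : x ∉ A₁ ∪ A₂ ∪ Q := by rw [← hT]; simp
    obtain ⟨hx1, hx2, hx3⟩ := notMem_union₃ hx
    have h2Q := hA.chain₂.append hA.core₂ hA.disj₂ hA.end₂
    have h2 := h2Q.cons (by simp [hx2, hx3]) hA.start₂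
    have h1 := hA.chain₁.cons hx1 hA.start₁
    have d1 : Disjoint A₁ (insert x (A₂ ∪ Q)) := by simp [hx1, hA.disj, hA.disj₁]
    have d2 : Disjoint (insert x A₁) (A₂ ∪ Q) := by simp [hx2, hx3, hA.disj, hA.disj₁]
    have s1 : S = A₁ ∪ insert x (A₂ ∪ Q) := by
      rw [hS, Finset.union_insert, Finset.union_assoc]
    have s2 : S = insert x A₁ ∪ (A₂ ∪ Q) := by
      rw [hS, Finset.insert_union, Finset.union_assoc]
    have k1 := Finset.card_union_of_disjoint d1
    have k2 := Finset.card_union_of_disjoint d2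
    rw [← s1] at k1
    rw [← s2] at k2
    have cx1 := Finset.card_insert_of_notMem hx1
    -- Only `|A₁| ≡ |A₂ ∪ Q| ≡ 1` escapes all four, and then `3 ∣ |S|`, which is excluded here.
    have m : 3 ∣ A₁.card ∨ 3 ∣ (insert x (A₂ ∪ Q)).card ∨ 3 ∣ (insert x A₁).card ∨
      3 ∣ (A₂ ∪ Q).card := by omega
    rcases m with m | m | m | m
    · exact split hA.chain₁ h2 s1 d1 m
    · exact split' hA.chain₁ h2 s1 d1 m
    · exact split h1 h2Q s2 d2 m
    · exact split' h1 h2Q s2 d2 m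
  by_cases m1 : S.card % 3 = 1
  · refine ⟨{x}, by simpa using h.left_mem, by simp [m1], by simp +contextual, ?_⟩
    rw [Finset.sdiff_singleton_eq_erase]
    exact (h'.tripleFactor hG (by omega)).of_deleteEdges
  have c2 : ((S.erase x).erase x').card + 1 = (S.erase x).card := Finset.card_erase_add_one hx'
  have finish : TripleFactor G ((S.erase x).erase x') → ∃ P ⊆ S, P.card = S.card % 3 ∧
      (∀ u ∈ P, ∀ v ∈ P, u ≠ v → G.Adj u v) ∧ TripleFactor G (S \ P) := by
    intro hf
    refine ⟨{x, x'}, ?_, ?_, ?_, ?_⟩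
    · exact Finset.insert_subset h.left_mem
        (Finset.singleton_subset_iff.2 (Finset.mem_of_mem_erase hx'))
    · rw [Finset.card_pair hxx'.ne]
      omega
    · have := hxx'.symm
      intro u hu v hv huv
      simp only [Finset.mem_insert, Finset.mem_singleton] at hu hv
      rcases hu with rfl | rfl <;> rcases hv with rfl | rfl <;> tauto
    · rwa [Finset.sdiff_insert, Finset.sdiff_singleton_eq_erase, Finset.erase_right_comm]
  by_cases hx'y : x' = y
  · subst hx'y
    refine finish ?_
    rw [h'.eq_singleton]
    simpa using TripleFactor.empty
  rcases h'.erase_left_or_arms hG hx'y with ⟨x'', hx'', hxx'', h''⟩ |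
    ⟨A₁, A₂, Q, a₁, b₁, d₁, a₂, b₂, d₂, hT, hA⟩
  · exact finish (h''.tripleFactor hG (by omega)).of_deleteEdges
  · have hne := hxx'.ne
    have hS : S = insert x (insert x' (A₁ ∪ A₂ ∪ Q)) := by
      rw [← hT, Finset.insert_erase hx', Finset.insert_erase h.left_mem]
    have hx : x ∉ A₁ ∪ A₂ ∪ Q := by rw [← hT]; simp
    have hx' : x' ∉ A₁ ∪ A₂ ∪ Q := by rw [← hT]; simp
    obtain ⟨hx1, hx2, hx3⟩ := notMem_union₃ hx
    obtain ⟨hx1', hx2', hx3'⟩ := notMem_union₃ hx'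
    have hxi : x ∉ insert x' A₁ := by simp [hne, hx1]
    have h2Q := hA.chain₂.append hA.core₂ hA.disj₂ hA.end₂
    have h2 := (h2Q.cons (by simp [hx2', hx3']) hA.start₂).cons (x := x)
      (by simp [hne, hx2, hx3]) hxx'
    have h1 := (hA.chain₁.cons hx1' hA.start₁).cons hxi hxx'
    have d1 : Disjoint A₁ (insert x (insert x' (A₂ ∪ Q))) := by
      simp [hx1, hx1', hA.disj, hA.disj₁]
    have d2 : Disjoint (insert x (insert x' A₁)) (A₂ ∪ Q) := by
      simp [hx2, hx3, hx2', hx3', hA.disj, hA.disj₁]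
    have s1 : S = A₁ ∪ insert x (insert x' (A₂ ∪ Q)) := by
      rw [hS, Finset.union_insert, Finset.union_insert, Finset.union_assoc]
    have s2 : S = insert x (insert x' A₁) ∪ (A₂ ∪ Q) := by
      rw [hS, Finset.insert_union, Finset.insert_union, Finset.union_assoc]
    have k1 := Finset.card_union_of_disjoint d1
    have k2 := Finset.card_union_of_disjoint d2
    rw [← s1] at k1
    rw [← s2] at k2
    have cx1 := Finset.card_insert_of_notMem hx1'
    have cx2 := Finset.card_insert_of_notMem hxi
    have m : 3 ∣ A₁.card ∨ 3 ∣ (insert x (insert x' (A₂ ∪ Q))).card ∨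
      3 ∣ (insert x (insert x' A₁)).card := by omega
    rcases m with m | m | m
    · exact split hA.chain₁ h2 s1 d1 m
    · exact split' hA.chain₁ h2 s1 d1 m
    · exact split h1 h2Q s2 d2 m

end TripleFactor

end SimpleGraph
namespace SimpleGraph

/-! ### From vertex partitions to path factors -/

section PathFactor

variable {V : Type*} {G : SimpleGraph V}

theorem Walk.conn {S : Finset V} : ∀ {u v : V} (w : G.Walk u v), (∀ z ∈ w.support, z ∈ S) →
    G.Conn S u v
  | _, _, .nil, _ => Conn.refl _ _
  | _, _, .cons h w, hS => (Conn.single h (hS _ (by simp)) (hS _ (by simp))).trans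
      (w.conn fun z hz => hS z (by simp [hz]))

variable [DecidableEq V]

/-- Since `x ≠ y`, at least one terminal survives the deletion of a vertex, and everything left is
joined to it. -/
theorem IsTwoConnected.isChain_univ [Fintype V] (h : G.IsTwoConnected) {x y : V} (hxy : x ≠ y) :
    G.IsChain Finset.univ x y := by
  refine ⟨Finset.mem_univ _, Finset.mem_univ _, fun w _ => ?_, ?_⟩
  · obtain ⟨p⟩ := h.2.1.preconnected w y
    exact p.conn fun z _ => Finset.mem_univ z
  · intro v _ w _ hwv
    have key : ∀ z, z ≠ v → G.Conn (Finset.univ.erase v) w z := by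
      intro z hz
      obtain ⟨p⟩ := (h.2.2 v).preconnected ⟨w, hwv⟩ ⟨z, hz⟩
      refine (p.map (Embedding.induce {v}ᶜ).toHom).conn fun t ht => ?_
      rw [Walk.support_map, List.mem_map] at ht
      obtain ⟨s, -, rfl⟩ := ht
      exact Finset.mem_erase.2 ⟨s.2, Finset.mem_univ _⟩
    by_cases hv : x = v
    · exact Or.inr (key y (hv ▸ hxy.symm))
    · exact Or.inl (key x hv)

/-- `S` can be partitioned into the vertex sets of paths of `G` with numbers of vertices in `N`. -/
inductive PathFactorOn (G : SimpleGraph V) (N : Set ℕ) : Finset V → Prop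
  | empty : PathFactorOn G N ∅
  | step {S : Finset V} {u v : V} (w : G.Walk u v) (hw : w.IsPath) (hn : w.length + 1 ∈ N)
      (hd : ∀ z ∈ w.support, z ∉ S) (h : PathFactorOn G N S) :
      PathFactorOn G N (w.support.toFinset ∪ S)

/-- `H` is the union of the chosen paths. Confining its edges to `S` keeps a newly added path from
interfering with the old ones. -/
theorem PathFactorOn.exists_le {N : Set ℕ} {S : Finset V} (h : PathFactorOn G N S) :
    ∃ H ≤ G, (∀ p q, H.Adj p q → p ∈ S) ∧ ∀ u ∈ S, ∃ (a b : V) (w : G.Walk a b), w.IsPath ∧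
      w.length + 1 ∈ N ∧ u ∈ w.support ∧ (∀ p ∈ w.support, p ∈ S) ∧
      ∀ p ∈ w.support, ∀ q, H.Adj p q ↔ w.toSubgraph.Adj p q := by
  induction h with
  | empty => exact ⟨⊥, bot_le, by simp, by simp⟩
  | @step S u v w hw hn hd _ ih =>
    obtain ⟨H, hHG, hHS, hH⟩ := ih
    have hwS : ∀ {p q}, w.toSubgraph.Adj p q → p ∈ w.support := fun h =>
      w.mem_verts_toSubgraph.1 h.fst_mem
    refine ⟨H ⊔ w.toSubgraph.spanningCoe, sup_le hHG w.toSubgraph.spanningCoe_le, ?_, ?_⟩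
    · rintro p q (h | h)
      · exact Finset.mem_union_right _ (hHS p q h)
      · exact Finset.mem_union_left _ (List.mem_toFinset.2 (hwS h))
    · intro z hz
      rcases Finset.mem_union.1 hz with hz | hz
      · refine ⟨u, v, w, hw, hn, List.mem_toFinset.1 hz, fun p hp =>
          Finset.mem_union_left _ (List.mem_toFinset.2 hp), fun p hp q => ?_⟩
        rw [sup_adj, Subgraph.spanningCoe_adj]
        exact or_iff_right fun h => hd p hp (hHS p q h)
      · obtain ⟨a, b, w', hw', hn', hz', hS', hadj⟩ := hH z hz
        refine ⟨a, b, w', hw', hn', hz', fun p hp => Finset.mem_union_right _ (hS' p hp),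
          fun p hp q => ?_⟩
        rw [sup_adj, Subgraph.spanningCoe_adj, ← hadj p hp]
        exact or_iff_left fun h => hd p (hwS h) (hS' p hp)

theorem PathFactorOn.hasPathFactor [Fintype V] {N : Set ℕ}
    (h : PathFactorOn G N Finset.univ) : G.HasPathFactor N := by
  obtain ⟨H, hHG, -, hH⟩ := h.exists_le
  refine ⟨H, hHG, fun c => ?_⟩
  obtain ⟨u, rfl⟩ := c.exists_rep
  obtain ⟨a, b, w, hw, hn, hu, -, hadj⟩ := hH u (Finset.mem_univ u)
  refine ⟨_, hn, ?_⟩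
  have hsupp : ∀ z, z ∈ (H.connectedComponentMk u).supp ↔ z ∈ w.support := by
    intro z
    rw [ConnectedComponent.mem_supp_iff, ConnectedComponent.eq]
    constructor
    · rintro ⟨p⟩
      have : ∀ {s t : V}, H.Walk s t → t ∈ w.support → s ∈ w.support := by
        intro s t p ht
        induction p with
        | nil => exact ht
        | cons h _ ih =>
          exact w.mem_verts_toSubgraph.1 ((hadj _ (ih ht) _).1 h.symm).snd_mem
      exact this p hu
    · intro hz
      let f : w.toSubgraph.coe →g H := ⟨Subtype.val, fun {p q} h =>
        (hadj p (w.mem_verts_toSubgraph.1 p.2) q).2 h⟩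
      exact ((w.toSubgraph_connected.preconnected ⟨z, w.mem_verts_toSubgraph.2 hz⟩
        ⟨u, w.mem_verts_toSubgraph.2 hu⟩).map f)
  let e : (H.connectedComponentMk u).toSimpleGraph ≃g w.toSubgraph.coe :=
    { toEquiv := Equiv.subtypeEquivRight fun z => (hsupp z).trans w.mem_verts_toSubgraph.symm
      map_rel_iff' := fun {p q} => (hadj p ((hsupp p).1 p.2) q).symm }
  exact ⟨e.trans hw.pathGraphIsoToSubgraph.symm⟩

theorem TripleFactor.pathFactorOn {N : Set ℕ} (hN : 3 ∈ N) {S : Finset V}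
    (h : TripleFactor G S) : PathFactorOn G N S := by
  induction h with
  | empty => exact .empty
  | @step S a b c hab hbc hac ha hb hc _ ih =>
    have := PathFactorOn.step (.cons hab (.cons hbc .nil))
      (by simp [hab.ne, hbc.ne, hac]) (by simpa using hN) (by simp [ha, hb, hc]) ih
    simpa [Finset.insert_union] using this

theorem TripleFactor.comap {W : Type*} [DecidableEq W] (f : W ↪ V) {S : Finset V}
    (h : TripleFactor G S) (hS : ∀ z ∈ S, z ∈ Set.range f) :
    ∀ T : Finset W, (∀ w, w ∈ T ↔ f w ∈ S) → TripleFactor (G.comap f) T := by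
  induction h with
  | empty =>
    intro T hT
    obtain rfl : T = ∅ := Finset.eq_empty_of_forall_notMem fun w hw => by simpa using (hT w).1 hw
    exact .empty
  | @step S a b c hab hbc hac ha hb hc _ ih =>
    intro T hT
    obtain ⟨a, rfl⟩ := hS a (by simp)
    obtain ⟨b, rfl⟩ := hS b (by simp)
    obtain ⟨c, rfl⟩ := hS c (by simp)
    have hT' : T = insert a (insert b (insert c (T.filter fun w => f w ∈ S))) := by
      ext w
      simp only [Finset.mem_insert, Finset.mem_filter, hT, f.injective.eq_iff]
      tauto
    rw [hT']
    refine step (H := G.comap f) hab hbc (fun h => hac (h ▸ rfl)) (by simp [ha]) (by simp [hb])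
      (by simp [hc]) (ih (fun z hz => hS z (by simp [hz])) _ fun w => ?_)
    simp only [Finset.mem_filter, hT, Finset.mem_insert]
    tauto

/-- Isolates the path through `u`, so that it can be merged with the leftover clique. -/
theorem TripleFactor.exists_triple {S : Finset V} (h : TripleFactor G S) {u : V} (hu : u ∈ S) :
    ∃ a b c, G.Adj a b ∧ G.Adj b c ∧ a ≠ c ∧ ({a, b, c} : Finset V) ⊆ S ∧ u ∈ ({a, b, c} : Finset V)
      ∧ TripleFactor G (S \ {a, b, c}) := by
  induction h with
  | empty => simp at hu
  | @step S a b c hab hbc hac ha hb hc h ih =>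
    by_cases hu' : u ∈ ({a, b, c} : Finset V)
    · refine ⟨a, b, c, hab, hbc, hac, ?_, hu', ?_⟩
      · intro z hz
        simp only [Finset.mem_insert, Finset.mem_singleton] at hz ⊢
        tauto
      · have : insert a (insert b (insert c S)) \ {a, b, c} = S := by
          ext z
          have h1 : z = a → z ∉ S := fun h => h ▸ ha
          have h2 : z = b → z ∉ S := fun h => h ▸ hb
          have h3 : z = c → z ∉ S := fun h => h ▸ hc
          simp only [Finset.mem_sdiff, Finset.mem_insert, Finset.mem_singleton]
          tauto
        rwa [this]
    · have huS : u ∈ S := by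
        simp only [Finset.mem_insert, Finset.mem_singleton] at hu hu'
        tauto
      obtain ⟨a', b', c', hab', hbc', hac', hs, hu'', hf⟩ := ih huS
      refine ⟨a', b', c', hab', hbc', hac', ?_, hu'', ?_⟩
      · exact hs.trans fun z hz => by simp [hz]
      · have hn : ∀ z, z ∉ S → z ∉ ({a', b', c'} : Finset V) := fun z hz h => hz (hs h)
        rw [Finset.insert_sdiff_of_notMem _ (hn a ha), Finset.insert_sdiff_of_notMem _ (hn b hb),
          Finset.insert_sdiff_of_notMem _ (hn c hc)]
        exact step hab hbc hac (by simp [ha]) (by simp [hb]) (by simp [hc]) hf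

/-- In a claw-free graph a vertex adjacent to a 3-vertex path extends it to a 4-vertex path
starting at that vertex. -/
theorem IsClawFree.exists_path_of_adj (hG : G.IsClawFree) {p a b c u : V}
    (hab : G.Adj a b) (hbc : G.Adj b c) (hac : a ≠ c) (hp : p ∉ ({a, b, c} : Finset V))
    (hu : u ∈ ({a, b, c} : Finset V)) (hpu : G.Adj p u) :
    ∃ a' b' c', G.Adj p a' ∧ G.Adj a' b' ∧ G.Adj b' c' ∧ a' ≠ c' ∧
      ({a', b', c'} : Finset V) = {a, b, c} := by
  have hrev : ({c, b, a} : Finset V) = {a, b, c} := by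
    ext z
    simp only [Finset.mem_insert, Finset.mem_singleton]
    tauto
  simp only [Finset.mem_insert, Finset.mem_singleton, not_or] at hp hu
  rcases hu with rfl | rfl | rfl
  · exact ⟨_, _, _, hpu, hab, hbc, hac, rfl⟩
  · rcases hG.adj_of_adj hpu.symm hab.symm hbc hp.1 hp.2.2 hac with h | h | h
    · exact ⟨_, _, _, h, hab, hbc, hac, rfl⟩
    · exact ⟨_, _, _, h, hbc.symm, hab.symm, hac.symm, hrev⟩
    · exact ⟨_, _, _, hpu, hab.symm, h, hbc.ne, Finset.insert_comm _ _ _⟩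
  · exact ⟨_, _, _, hpu, hbc.symm, hab.symm, hac.symm, hrev⟩

theorem TripleFactor.hasLambdaFactor_compl [Fintype V] {S : Finset V}
    (h : TripleFactor G (Finset.univ \ S)) (T : Set V) (hT : ∀ z, z ∈ T ↔ z ∉ S) :
    (G.induce T).HasLambdaFactor := by
  classical
  refine PathFactorOn.hasPathFactor (TripleFactor.pathFactorOn (by simp) ?_)
  refine h.comap (Function.Embedding.subtype (· ∈ T)) ?_ _ fun w => ?_
  · intro z hz
    exact ⟨⟨z, (hT z).2 (Finset.mem_sdiff.1 hz).2⟩, rfl⟩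
  · simpa using (hT w).1 w.2

/-- The two conclusions drawn from a path whose complement is factored into 3-vertex paths. -/
theorem TripleFactor.path_conclusions [Fintype V] {u v : V} (w : G.Walk u v) (hw : w.IsPath)
    {n : ℕ} (hn : w.length + 1 = n) (h : TripleFactor G (Finset.univ \ w.support.toFinset)) :
    (∃ P : G.Subgraph, P.IsPathOn n ∧ (G.deleteSubgraph P).HasLambdaFactor) ∧
      G.HasPathFactor {3, n} := by
  subst hn
  constructor
  · exact ⟨w.toSubgraph, ⟨hw.pathGraphIsoToSubgraph.symm⟩,
      h.hasLambdaFactor_compl _ fun z => by simp⟩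
  · have := PathFactorOn.step (N := {3, w.length + 1}) w hw (by simp) (by simp)
      (h.pathFactorOn (by simp))
    rw [Finset.union_sdiff_of_subset (Finset.subset_univ _)] at this
    exact this.hasPathFactor

end PathFactor

end SimpleGraph

/-! ### The theorem -/

theorem mainTheorem1 {V : Type*} [Finite V] (G : SimpleGraph V)
    (h2 : G.IsTwoConnected) (hclaw : G.IsClawFree) :
    (Nat.card V ≡ 0 [MOD 3] →
      ∀ e ∈ G.edgeSet, (G.deleteEdges {e}).HasLambdaFactor) ∧
    (∀ k : ℕ, k = 1 ∨ k = 2 → Nat.card V ≡ k [MOD 3] →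
      (∃ P : G.Subgraph, P.IsPathOn k ∧ (G.deleteSubgraph P).HasLambdaFactor) ∧
      (∃ Q : G.Subgraph, Q.IsPathOn (k + 3) ∧ (G.deleteSubgraph Q).HasLambdaFactor) ∧
      G.HasPathFactor {3, k} ∧
      G.HasPathFactor {3, k + 3}) := by
  classical
  cases nonempty_fintype V
  constructor
  · intro hmod e he
    induction e with
    | _ x y =>
    have hxy : x ≠ y := (G.mem_edgeSet.1 he).ne
    refine SimpleGraph.PathFactorOn.hasPathFactor (SimpleGraph.TripleFactor.pathFactorOn (by simp)
      ((h2.isChain_univ hxy).tripleFactor hclaw ?_))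
    rw [Finset.card_univ, ← Nat.card_eq_fintype_card]
    exact (Nat.modEq_zero_iff_dvd).1 hmod
  · intro k hk hmod
    have hc : 2 < Fintype.card V := by
      have := h2.1
      rw [ENat.card_eq_coe_fintype_card] at this
      exact_mod_cast this
    obtain ⟨x, y, hxy⟩ := Fintype.exists_pair_of_one_lt_card (α := V) (by omega)
    obtain ⟨P, -, hP, hcl, hf⟩ := (h2.isChain_univ hxy).exists_clique_tripleFactor hclaw
    have hPk : P.card = k := by
      rw [hP, Finset.card_univ, ← Nat.card_eq_fintype_card, hmod]
      rcases hk with rfl | rfl <;> rfl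
    -- `P` is proper because it has at most two vertices and `G` at least three.
    have hex : ∃ p ∈ P, ∃ u ∈ Finset.univ \ P, G.Adj p u := by
      obtain ⟨p, hp⟩ : P.Nonempty := Finset.card_pos.1 (by omega)
      obtain ⟨z, hz⟩ : ∃ z, z ∉ P := by
        by_contra! hall
        have := Finset.card_univ (α := V)
        rw [← Finset.eq_univ_iff_forall.2 hall] at this
        omega
      obtain ⟨w⟩ := h2.2.1.preconnected p z
      obtain ⟨a, b, ha, hb, hab, -, -⟩ :=
        (w.conn (S := Finset.univ) fun z _ => Finset.mem_univ z).exists_exit hp hz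
      exact ⟨a, ha, b, by simpa using hb, hab⟩
    obtain ⟨p, hp, u, hu, hpu⟩ := hex
    obtain ⟨a, b, c, hab, hbc, hac, hs, hu', hf'⟩ := hf.exists_triple hu
    have hPn : ∀ z ∈ P, z ∉ ({a, b, c} : Finset V) := fun z hz h =>
      (Finset.mem_sdiff.1 (hs h)).2 hz
    obtain ⟨a', b', c', hpa, hab', hbc', hac', hset⟩ :=
      hclaw.exists_path_of_adj hab hbc hac (hPn p hp) hu' hpu
    rw [← hset] at hPn hf'
    have hsd : (Finset.univ \ P) \ {a', b', c'} = Finset.univ \ (P ∪ {a', b', c'}) := by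
      ext z
      simp only [Finset.mem_sdiff, Finset.mem_union]
      tauto
    rw [hsd] at hf'
    have hp3 := hPn p hp
    simp only [Finset.mem_insert, Finset.mem_singleton, not_or] at hp3
    rcases hk with rfl | rfl
    · obtain ⟨q, rfl⟩ := Finset.card_eq_one.1 hPk
      rw [Finset.mem_singleton] at hp
      subst hp
      have r1 := SimpleGraph.TripleFactor.path_conclusions (G := G) (u := p) .nil (by simp)
        (n := 1) rfl (by simpa using hf)
      have r2 := SimpleGraph.TripleFactor.path_conclusions (G := G)
        (.cons hpa (.cons hab' (.cons hbc' .nil)))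
        (by simp [hp3, hab'.ne, hbc'.ne, hac']) (n := 1 + 3) rfl
        (by convert hf' using 2; ext z; simp; tauto)
      exact ⟨r1.1, r2.1, r1.2, r2.2⟩
    -- Name the vertices so that `p`, the one with the edge leaving `P`, comes last in `P_2` and the
    -- 5-vertex path can continue from it.
    · obtain ⟨q, hqp, rfl⟩ : ∃ q, q ≠ p ∧ P = {q, p} := by
        obtain ⟨s, t, hst, rfl⟩ := Finset.card_eq_two.1 hPk
        simp only [Finset.mem_insert, Finset.mem_singleton] at hp
        rcases hp with rfl | rfl
        · exact ⟨t, hst.symm, Finset.pair_comm _ _⟩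
        · exact ⟨s, hst, rfl⟩
      have hq3 := hPn q (by simp)
      simp only [Finset.mem_insert, Finset.mem_singleton, not_or] at hq3
      have hadj : G.Adj q p := hcl q (by simp) p (by simp) hqp
      have r1 := SimpleGraph.TripleFactor.path_conclusions (G := G) (.cons hadj .nil)
        (by simp [hqp]) (n := 2) rfl (by simpa using hf)
      have r2 := SimpleGraph.TripleFactor.path_conclusions (G := G)
        (.cons hadj (.cons hpa (.cons hab' (.cons hbc' .nil))))
        (by simp [hqp, hq3, hp3, hab'.ne, hbc'.ne, hac']) (n := 2 + 3) rfl
        (by convert hf' using 2; ext z; simp; tauto)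
      exact ⟨r1.1, r2.1, r1.2, r2.2⟩
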